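/- Let $A,C\in\mathbb R^{n\times n}$ and $B\in\mathbb R^{n\times m}$ with $C$ nonsingular, and consider $$x(t+1)=Ax(t)+Bu(t)+w(t),\qquad y(t)=Cx(t)+v(t),\qquad t=0,1,2,\dots$$ The initial state $x(0)=x_0$ is Gaussian. The $w(t)$ are i.i.d. with $\Pr(w(t)=w_i)=p_i$ for given vectors $w_1,\dots,w_M$. The $v(t)$ are i.i.d. with mean $0$, $\|v(t)\|\le v_b$ almost surely, and $Q_v=E[v(t)v(t)']$. The variables $x_0,w(0),w(1),\dots,v(0),v(1),\dots$ are mutually independent. Vector norms are Euclidean, matrix norms are the induced norms, and $'$ is the transpose. Put $\mu_w=\sum_i p_iw_i$, $Q_w=\sum_i p_iw_iw_i'$, $C_w=Q_w-\mu_w\mu_w'$, $\bar Q_v=C^{-1}Q_v(C^{-1})'$. For a horizon $T\ge 0$ and a causal output-feedback policy $u$ ($u(t)$ is a function of $y(0),\dots,y(t),u(0),\dots,u(t-1)$) let $$J_T(u)=\sum_{t=0}^{T}E[x(t)'Q(t)x(t)+u(t)'R(t)u(t)]+E[x(T+1)'P_{T+1}x(T+1)],$$ where $Q(t)\ge0$,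 $R(t)>0$, $P_{T+1}\ge0$ are symmetric. Let $P_T(T+1)=P_{T+1}$, $L_T(T+1)=0$ and, for $t=T,T-1,\dots,0$, $$\Upsilon_T(t)=R(t)+B'P_T(t+1)B,$$ $$P_T(t)=A'P_T(t+1)A+Q(t)-A'P_T(t+1)B\Upsilon_T(t)^{-1}B'P_T(t+1)A,$$ $$L_T(t)=\big(A'-A'P_T(t+1)B\Upsilon_T(t)^{-1}B'\big)\big(P_T(t+1)+L_T(t+1)\big),$$ $$D_T(t)=(P_T(t+1)+L_T(t+1))'B\Upsilon_T(t)^{-1}B'(P_T(t+1)+L_T(t+1)),$$ $$H_T=\sum_{t=0}^T\Big\{-\mu_w'D_T(t)\mu_w+2\mu_w'L_T(t+1)\mu_w+\mathrm{Tr}\big(A'P_T(t+1)B\Upsilon_T(t)^{-1}B'P_T(t+1)A\bar Q_v\big)+\mathrm{Tr}(P_T(t+1)Q_w)\Big\}-\mathrm{Tr}(P_T(0)\bar Q_v).$$ Let $\hat x(t)=C^{-1}y(t)$. The offline policy, which knows $(p_i)$, is $$u_a(t)=-\Upsilon_T(t)^{-1}\big(B'P_T(t+1)A\hat x(t)+B'P_T(t+1)\mu_w+B'L_T(t+1)\mu_w\big).$$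 The learning policy $\hat u_a$, which does not know $(p_i)$, is obtained from the same formula by replacing $\mu_w$ by $\hat\mu_w(t)=\sum_i\hat p_i(t)w_i$, where $\hat p_i(0)=0$ and, for $t\ge1$, $\hat p_i(t)=\frac1t\#\{s<t:h(s)=i\}$ with $h(s)\in\arg\min_i\|\hat w(s)-w_i\|$ and $\hat w(s)=\hat x(s+1)-A\hat x(s)-Bu(s)$. Assume (H3): $\|w_i-w_j\|>2(1+\|A\|)\,\|C^{-1}\|\,v_b$ for all $i\ne j$. Then the following hold. 1. Under $\hat u_a$, almost surely, for all $t$, the minimizers of $i\mapsto\|\hat w(t)-w_i\|$ are exactly the $i$ with $w(t)=w_i$. Hence $\hat p_i(t)=\frac1t\#\{s<t:w(s)=w_i\}$ for $t\ge1$. 2. For every $T$ one has $D_T(t)\ge0$ for $0\le t\le T$, all expectations in $J_T(\hat u_a)$ are finite, and $$J_T(\hat u_a)=E\big[\hat x(0)'P_T(0)\hat x(0)+2\hat x(0)'L_T(0)\mu_w\big]+H_T+\mathrm{Tr}(D_T(0)\mu_w\mu_w')+\sum_{t=1}^T\frac1t\mathrm{Tr}(D_T(t)C_w).$$ 3. For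 every $T$, all expectations in $J_T(u_a)$ are finite, and the quasi-regret is $$J_T(\hat u_a)-J_T(u_a)=\mathrm{Tr}(D_T(0)\mu_w\mu_w')+\sum_{t=1}^T\frac1t\mathrm{Tr}(D_T(t)C_w).$$ 4. If moreover (H1) $Q(t)=Q$ and $R(t)=R$ for all $t$, and $P_{T+1}=0$ for all $T$, and (H2) $(A,B)$ is stabilizable and $(A,Q^{1/2})$ is observable, then $J_T(\hat u_a)-J_T(u_a)=O(\ln T)$ as $T\to\infty$. -/

import Mathlib

open MeasureTheory ProbabilityTheory Filter Topology Matrix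

noncomputable section

namespace OutputFeedback

/-- The Euclidean norm of a vector (not the sup norm that the type `Fin n → ℝ` carries). -/
def vecNorm {n : ℕ} (z : Fin n → ℝ) : ℝ := ‖WithLp.toLp 2 z‖

/-- The operator norm of a square matrix with respect to the Euclidean norm. -/
def opNorm {n : ℕ} (A : Matrix (Fin n) (Fin n) ℝ) : ℝ :=
  ‖Matrix.toEuclideanCLM (n := Fin n) (𝕜 := ℝ) A‖

/-- The data known to the decision maker: the system matrices `A`, `B`, `C`, the weights `Q(t)`,
`R(t)`, the terminal weight (`Pterm T` is the matrix `P_{T+1}` for horizon `T`) and the possible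
values `w_1, …, w_M` of the system noise. The probabilities of these values are not part of it. -/
structure Model (n m M : ℕ) where
  A : Matrix (Fin n) (Fin n) ℝ
  B : Matrix (Fin n) (Fin m) ℝ
  C : Matrix (Fin n) (Fin n) ℝ
  Q : ℕ → Matrix (Fin n) (Fin n) ℝ
  R : ℕ → Matrix (Fin m) (Fin m) ℝ
  Pterm : ℕ → Matrix (Fin n) (Fin n) ℝ
  atom : Fin M → Fin n → ℝ

variable {n m M : ℕ}

/-! Riccati and adjoint recursions, backwards in time from `T + 1`. -/

/-- `P_T(t)`: the Riccati recursion for `t ≤ T`, with `P_T(T+1) = P_{T+1}`. -/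
def riccati (D : Model n m M) (T t : ℕ) : Matrix (Fin n) (Fin n) ℝ :=
  if t ≤ T then
    D.Aᵀ * riccati D T (t + 1) * D.A + D.Q t
      - D.Aᵀ * riccati D T (t + 1) * D.B
        * (D.R t + D.Bᵀ * riccati D T (t + 1) * D.B)⁻¹ * D.Bᵀ * riccati D T (t + 1) * D.A
  else D.Pterm T
termination_by T + 1 - t

/-- `Υ_T(t) = R(t) + B' P_T(t+1) B`. -/
def upsilon (D : Model n m M) (T t : ℕ) : Matrix (Fin m) (Fin m) ℝ :=
  D.R t + D.Bᵀ * riccati D T (t + 1) * D.B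

/-- `L_T(t) = (A' - A' P_T(t+1) B Υ_T(t)⁻¹ B') (P_T(t+1) + L_T(t+1))` for `t ≤ T`,
with `L_T(T+1) = 0`. -/
def adjointL (D : Model n m M) (T t : ℕ) : Matrix (Fin n) (Fin n) ℝ :=
  if t ≤ T then
    (D.Aᵀ - D.Aᵀ * riccati D T (t + 1) * D.B * (upsilon D T t)⁻¹ * D.Bᵀ)
      * (riccati D T (t + 1) + adjointL D T (t + 1))
  else 0
termination_by T + 1 - t

/-- `D_T(t) = (P_T(t+1) + L_T(t+1))' B Υ_T(t)⁻¹ B' (P_T(t+1) + L_T(t+1))`. -/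
def dMat (D : Model n m M) (T t : ℕ) : Matrix (Fin n) (Fin n) ℝ :=
  (riccati D T (t + 1) + adjointL D T (t + 1))ᵀ * D.B * (upsilon D T t)⁻¹ * D.Bᵀ
    * (riccati D T (t + 1) + adjointL D T (t + 1))

/-! Policies and closed loops. -/

/-- A causal output-feedback policy: at time `t` the input is a function of the measurements
`y(0), …, y(t)` and of the past inputs `u(0), …, u(t-1)`. -/
abbrev Policy (n m : ℕ) : Type :=
  (t : ℕ) → (Fin (t + 1) → Fin n → ℝ) → (Fin t → Fin m → ℝ) → Fin m → ℝ

/-- One run of the closed loop, for an initial state `x₀` and noise sequences `w`, `v`: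
`x(t)` together with the past measurements `y(0), …, y(t-1)` and inputs `u(0), …, u(t-1)`. -/
def run (D : Model n m M) (π : Policy n m) (x₀ : Fin n → ℝ) (w v : ℕ → Fin n → ℝ) :
    (t : ℕ) → (Fin n → ℝ) × (Fin t → Fin n → ℝ) × (Fin t → Fin m → ℝ)
  | 0 => (x₀, Fin.elim0, Fin.elim0)
  | t + 1 =>
    let r := run D π x₀ w v t
    let y : Fin (t + 1) → Fin n → ℝ := Fin.snoc (α := fun _ => Fin n → ℝ) r.2.1 (D.C *ᵥ r.1 + v t)
    let u : Fin m → ℝ := π t y r.2.2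
    (D.A *ᵥ r.1 + D.B *ᵥ u + w t, y, Fin.snoc (α := fun _ => Fin m → ℝ) r.2.2 u)

variable {Ω : Type*}

/-- The state process `x(t)` under the policy `π`. -/
def state (D : Model n m M) (π : Policy n m) (x₀ : Ω → Fin n → ℝ) (w v : ℕ → Ω → Fin n → ℝ)
    (t : ℕ) (ω : Ω) : Fin n → ℝ :=
  (run D π (x₀ ω) (fun s => w s ω) (fun s => v s ω) t).1

/-- The measurement process `y(t) = C x(t) + v(t)` under the policy `π`. -/
def output (D : Model n m M) (π : Policy n m) (x₀ : Ω → Fin n → ℝ) (w v : ℕ → Ω → Fin n → ℝ)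
    (t : ℕ) (ω : Ω) : Fin n → ℝ :=
  D.C *ᵥ state D π x₀ w v t ω + v t ω

/-- The input process `u(t)` under the policy `π`. -/
def input (D : Model n m M) (π : Policy n m) (x₀ : Ω → Fin n → ℝ) (w v : ℕ → Ω → Fin n → ℝ)
    (t : ℕ) (ω : Ω) : Fin m → ℝ :=
  (run D π (x₀ ω) (fun s => w s ω) (fun s => v s ω) (t + 1)).2.2 (Fin.last t)

/-- The one-step state estimate `x̂(t) = C⁻¹ y(t)` under the policy `π`. -/
def stateEst (D : Model n m M) (π : Policy n m) (x₀ : Ω → Fin n → ℝ) (w v : ℕ → Ω → Fin n → ℝ)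
    (t : ℕ) (ω : Ω) : Fin n → ℝ :=
  D.C⁻¹ *ᵥ output D π x₀ w v t ω

/-- `ŵ(t) = x̂(t+1) - A x̂(t) - B u(t)` under the policy `π`. -/
def noiseEst (D : Model n m M) (π : Policy n m) (x₀ : Ω → Fin n → ℝ) (w v : ℕ → Ω → Fin n → ℝ)
    (t : ℕ) (ω : Ω) : Fin n → ℝ :=
  stateEst D π x₀ w v (t + 1) ω - D.A *ᵥ stateEst D π x₀ w v t ω - D.B *ᵥ input D π x₀ w v t ω

theorem run_outputs (D : Model n m M) (π : Policy n m) (x₀ : Ω → Fin n → ℝ)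
    (w v : ℕ → Ω → Fin n → ℝ) (t : ℕ) (ω : Ω) :
    (run D π (x₀ ω) (fun s => w s ω) (fun s => v s ω) t).2.1
      = fun s : Fin t => output D π x₀ w v s ω := by
  induction t with
  | zero => funext s; exact s.elim0
  | succ t ih =>
    funext s
    refine Fin.lastCases ?_ (fun s => ?_) s
    · simp [run, output, state]
    · simp [run, ih]

theorem run_inputs (D : Model n m M) (π : Policy n m) (x₀ : Ω → Fin n → ℝ)
    (w v : ℕ → Ω → Fin n → ℝ) (t : ℕ) (ω : Ω) :
    (run D π (x₀ ω) (fun s => w s ω) (fun s => v s ω) t).2.2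
      = fun s : Fin t => input D π x₀ w v s ω := by
  induction t with
  | zero => funext s; exact s.elim0
  | succ t ih =>
    funext s
    refine Fin.lastCases ?_ (fun s => ?_) s
    · simp [input]
    · simp [run, ih]

/-- The initial condition `x(0) = x₀` of the closed loop. -/
theorem state_zero (D : Model n m M) (π : Policy n m) (x₀ : Ω → Fin n → ℝ)
    (w v : ℕ → Ω → Fin n → ℝ) (ω : Ω) : state D π x₀ w v 0 ω = x₀ ω := rfl

/-- The input of the closed loop is the policy applied to the observed history. -/
theorem input_eq (D : Model n m M) (π : Policy n m) (x₀ : Ω → Fin n → ℝ)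
    (w v : ℕ → Ω → Fin n → ℝ) (t : ℕ) (ω : Ω) :
    input D π x₀ w v t ω = π t (fun s => output D π x₀ w v s ω)
      (fun s => input D π x₀ w v s ω) := by
  rw [← run_outputs, ← run_inputs]
  simp [input, run]

/-- The state equation `x(t+1) = A x(t) + B u(t) + w(t)` of the closed loop. -/
theorem state_succ (D : Model n m M) (π : Policy n m) (x₀ : Ω → Fin n → ℝ)
    (w v : ℕ → Ω → Fin n → ℝ) (t : ℕ) (ω : Ω) :
    state D π x₀ w v (t + 1) ω
      = D.A *ᵥ state D π x₀ w v t ω + D.B *ᵥ input D π x₀ w v t ω + w t ω := by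
  simp [state, input, run]

/-! The two policies. -/

/-- `-Υ_T(t)⁻¹ (B' P_T(t+1) A x̂ + B' P_T(t+1) μ + B' L_T(t+1) μ)`. -/
def feedback (D : Model n m M) (T t : ℕ) (xhat μ : Fin n → ℝ) : Fin m → ℝ :=
  -((upsilon D T t)⁻¹ *ᵥ
    ((D.Bᵀ * riccati D T (t + 1) * D.A) *ᵥ xhat + (D.Bᵀ * riccati D T (t + 1)) *ᵥ μ
      + (D.Bᵀ * adjointL D T (t + 1)) *ᵥ μ))

/-- The index of a value `w_i` nearest to `z` in Euclidean distance (`argmin_i ‖z - w_i‖`). -/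
def nearestIndex [NeZero M] (a : Fin M → Fin n → ℝ) (z : Fin n → ℝ) : Fin M :=
  Classical.choose (Finite.exists_min fun i => vecNorm (z - a i))

theorem nearestIndex_spec [NeZero M] (a : Fin M → Fin n → ℝ) (z : Fin n → ℝ) (i : Fin M) :
    vecNorm (z - a (nearestIndex a z)) ≤ vecNorm (z - a i) :=
  Classical.choose_spec (Finite.exists_min fun i => vecNorm (z - a i)) i

/-- The estimate `(1/t) ∑_{s<t} ξ_{h(s)}` of the probability vector from observed indices
`h(0), …, h(t-1)`, where `ξ_i` is the `i`-th unit vector; it is `0` for `t = 0`. -/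
def probEst {t : ℕ} (h : Fin t → Fin M) : Fin M → ℝ :=
  (1 / (t : ℝ)) • ∑ s : Fin t, (Pi.single (h s) 1 : Fin M → ℝ)

/-- `W p = ∑ i, p_i w_i`; this is `μ_w` if `p` is the vector of noise probabilities. -/
def meanOf (a : Fin M → Fin n → ℝ) (p : Fin M → ℝ) : Fin n → ℝ := ∑ i, p i • a i

/-- The estimate of the noise probabilities at time `t`, computed from the observed history: each
`ŵ(s) = C⁻¹ y(s+1) - A C⁻¹ y(s) - B u(s)` with `s < t` is replaced by the nearest `w_i`. -/
def historyProbEst [NeZero M] (D : Model n m M) (t : ℕ) (y : Fin (t + 1) → Fin n → ℝ)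
    (u : Fin t → Fin m → ℝ) : Fin M → ℝ :=
  probEst fun s : Fin t =>
    nearestIndex D.atom (D.C⁻¹ *ᵥ y s.succ - D.A *ᵥ (D.C⁻¹ *ᵥ y s.castSucc) - D.B *ᵥ u s)

/-- The learning policy `û_a` for horizon `T`; it does not know the noise probabilities. -/
def learningPolicy [NeZero M] (D : Model n m M) (T : ℕ) : Policy n m := fun t y u =>
  feedback D T t (D.C⁻¹ *ᵥ y (Fin.last t)) (meanOf D.atom (historyProbEst D t y u))

/-- The suboptimal offline policy `u_a` for horizon `T`, which knows the probabilities `p`. -/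
def offlinePolicy (D : Model n m M) (p : Fin M → ℝ) (T : ℕ) : Policy n m := fun t y _ =>
  feedback D T t (D.C⁻¹ *ᵥ y (Fin.last t)) (meanOf D.atom p)

/-! Cost. -/

/-- `x(t)' Q(t) x(t) + u(t)' R(t) u(t)`. -/
def stageCost (D : Model n m M) (π : Policy n m) (x₀ : Ω → Fin n → ℝ) (w v : ℕ → Ω → Fin n → ℝ)
    (t : ℕ) (ω : Ω) : ℝ :=
  state D π x₀ w v t ω ⬝ᵥ (D.Q t *ᵥ state D π x₀ w v t ω)
    + input D π x₀ w v t ω ⬝ᵥ (D.R t *ᵥ input D π x₀ w v t ω)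

/-- `x(T+1)' P_{T+1} x(T+1)`. -/
def terminalCost (D : Model n m M) (π : Policy n m) (x₀ : Ω → Fin n → ℝ)
    (w v : ℕ → Ω → Fin n → ℝ) (T : ℕ) (ω : Ω) : ℝ :=
  state D π x₀ w v (T + 1) ω ⬝ᵥ (D.Pterm T *ᵥ state D π x₀ w v (T + 1) ω)

/-- All expectations in the cost of horizon `T` are expectations of integrable variables. -/
def CostIntegrable [MeasurableSpace Ω] (P : Measure Ω) (D : Model n m M) (π : Policy n m)
    (x₀ : Ω → Fin n → ℝ) (w v : ℕ → Ω → Fin n → ℝ) (T : ℕ) : Prop :=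
  (∀ t ≤ T, Integrable (stageCost D π x₀ w v t) P) ∧ Integrable (terminalCost D π x₀ w v T) P

/-- The expected cost `J_T` of the policy `π`. -/
def cost [MeasurableSpace Ω] (P : Measure Ω) (D : Model n m M) (π : Policy n m)
    (x₀ : Ω → Fin n → ℝ) (w v : ℕ → Ω → Fin n → ℝ) (T : ℕ) : ℝ :=
  ∑ t ∈ Finset.range (T + 1), ∫ ω, stageCost D π x₀ w v t ω ∂P
    + ∫ ω, terminalCost D π x₀ w v T ω ∂P

/-- The quasi-regret of the learning policy: its cost minus that of the offline policy. -/
def quasiRegret [NeZero M] [MeasurableSpace Ω] (P : Measure Ω) (D : Model n m M) (p : Fin M → ℝ)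
    (x₀ : Ω → Fin n → ℝ) (w v : ℕ → Ω → Fin n → ℝ) (T : ℕ) : ℝ :=
  cost P D (learningPolicy D T) x₀ w v T - cost P D (offlinePolicy D p T) x₀ w v T

/-! Second-order statistics and the constant in the cost formula. -/

/-- `Q_w = ∑ i, p_i w_i w_i'`. -/
def secondMoment (a : Fin M → Fin n → ℝ) (p : Fin M → ℝ) : Matrix (Fin n) (Fin n) ℝ :=
  ∑ i, p i • vecMulVec (a i) (a i)

/-- `C_w = Q_w - μ_w μ_w'`. -/
def covariance (a : Fin M → Fin n → ℝ) (p : Fin M → ℝ) : Matrix (Fin n) (Fin n) ℝ :=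
  secondMoment a p - vecMulVec (meanOf a p) (meanOf a p)

/-- `E[z z']` for a random vector `z`. -/
def momentMatrix [MeasurableSpace Ω] (P : Measure Ω) (z : Ω → Fin n → ℝ) :
    Matrix (Fin n) (Fin n) ℝ :=
  Matrix.of fun i j => ∫ ω, z ω i * z ω j ∂P

/-- The constant `H_T` of the cost formula, where `Qbar = C⁻¹ Q_v (C⁻¹)'`. -/
def hConst (D : Model n m M) (p : Fin M → ℝ) (Qbar : Matrix (Fin n) (Fin n) ℝ) (T : ℕ) : ℝ :=
  ∑ t ∈ Finset.range (T + 1),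
    (-(meanOf D.atom p ⬝ᵥ (dMat D T t *ᵥ meanOf D.atom p))
      + 2 * (meanOf D.atom p ⬝ᵥ (adjointL D T (t + 1) *ᵥ meanOf D.atom p))
      + (D.Aᵀ * riccati D T (t + 1) * D.B * (upsilon D T t)⁻¹ * D.Bᵀ * riccati D T (t + 1) * D.A
          * Qbar).trace
      + (riccati D T (t + 1) * secondMoment D.atom p).trace)
    - (riccati D T 0 * Qbar).trace

/-! Stabilizability and observability. -/

/-- `(A, B)` is stabilizable: some linear state feedback `u = K z` makes
`z(t+1) = (A + B K) z(t)` asymptotically stable. -/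
def Stabilizable (A : Matrix (Fin n) (Fin n) ℝ) (B : Matrix (Fin n) (Fin m) ℝ) : Prop :=
  ∃ K : Matrix (Fin m) (Fin n) ℝ, ∀ z : Fin n → ℝ,
    Tendsto (fun k : ℕ => ((A + B * K) ^ k) *ᵥ z) atTop (𝓝 0)

/-- `(A, S)` is observable: only the zero initial state of `z(t+1) = A z(t)` has the output
`S z(t)` equal to zero at all times. -/
def Observable (A S : Matrix (Fin n) (Fin n) ℝ) : Prop :=
  ∀ z : Fin n → ℝ, (∀ k : ℕ, S *ᵥ ((A ^ k) *ᵥ z) = 0) → z = 0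

end OutputFeedback

end

/-!
Since `x̂(t) = x(t) + C⁻¹ v(t)`, the error of `ŵ(t)` is at most `(1 + ‖A‖) ‖C⁻¹‖ v_b`, less than
half the distance of two values of the noise. So the nearest value is the true one, and the
learning policy is the certainty-equivalent feedback with the sample mean of `w(0), …, w(t-1)`
in place of `μ_w`. By completing the square in the Bellman equation, a feedback that uses an
estimate `ν` of `μ_w` pays the additional cost `E[(μ_w - ν)' D_T(t) (μ_w - ν)]` at time `t`. For
the sample mean this is `Tr(D_T(t) C_w) / t` if `t ≥ 1`, and `Tr(D_T(0) μ_w μ_w')` if `t = 0`;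
for the offline policy it vanishes.

For constant weights, `D_T(t)` depends on `T - t` only. The Riccati iterates started at `0`
increase and stay below the Lyapunov iterates of a stabilizing feedback, so they converge to a
fixed point `V`. Along the closed loop of `V` the quadratic form of `V` is a Lyapunov function,
and observability with LaSalle's principle makes this loop asymptotically stable. The matrices
`L` then follow an affine recursion whose linear part tends to a stable map, so they are
bounded, and so is `D_T(t)`. Summing the weights `1/t` gives the logarithm.
-/

noncomputable section

namespace OutputFeedback

section QuadraticForms

variable {ι κ 𝕜 : Type*} [Fintype ι] [CommRing 𝕜]

theorem dotProduct_mulVec_comm_of_isSymm {N : Matrix ι ι 𝕜} (hN : N.IsSymm) (x y : ι → 𝕜) :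
    x ⬝ᵥ N *ᵥ y = y ⬝ᵥ N *ᵥ x := by
  rw [← dotProduct_transpose_mulVec, hN.eq]

theorem isSymm_transpose_mul_mul {N : Matrix ι ι 𝕜} (hN : N.IsSymm) (F : Matrix ι κ 𝕜) :
    (Fᵀ * N * F).IsSymm := by
  rw [IsSymm, transpose_mul, transpose_mul, transpose_transpose, hN.eq, Matrix.mul_assoc]

theorem quadratic_add {N : Matrix ι ι 𝕜} (hN : N.IsSymm) (x y : ι → 𝕜) :
    (x + y) ⬝ᵥ N *ᵥ (x + y) = x ⬝ᵥ N *ᵥ x + 2 * (x ⬝ᵥ N *ᵥ y) + y ⬝ᵥ N *ᵥ y := by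
  rw [mulVec_add, dotProduct_add, add_dotProduct, add_dotProduct,
    dotProduct_mulVec_comm_of_isSymm hN y x]
  ring

variable [Fintype κ]

theorem mulVec_dotProduct_eq_dotProduct_transpose_mulVec (N : Matrix κ ι 𝕜) (x : ι → 𝕜)
    (y : κ → 𝕜) : (N *ᵥ x) ⬝ᵥ y = x ⬝ᵥ Nᵀ *ᵥ y := by
  rw [dotProduct_transpose_mulVec, dotProduct_comm]

theorem mulVec_dotProduct_mulVec_mulVec (N : Matrix ι ι 𝕜) (F : Matrix ι κ 𝕜) (x y : κ → 𝕜) :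
    (F *ᵥ x) ⬝ᵥ N *ᵥ (F *ᵥ y) = x ⬝ᵥ (Fᵀ * N * F) *ᵥ y := by
  rw [← mulVec_mulVec, ← mulVec_mulVec, ← mulVec_dotProduct_eq_dotProduct_transpose_mulVec]

theorem trace_mul_mul_mul_transpose (N : Matrix ι ι 𝕜) (F : Matrix ι κ 𝕜) (S : Matrix κ κ 𝕜) :
    (N * (F * S * Fᵀ)).trace = (Fᵀ * N * F * S).trace := by
  rw [← Matrix.mul_assoc, trace_mul_comm]
  simp only [Matrix.mul_assoc]

theorem quadratic_add_linear_eq_completed_square [DecidableEq ι] {N : Matrix ι ι 𝕜}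
    (hN : N.IsSymm) (hdet : IsUnit N.det) (u b : ι → 𝕜) :
    u ⬝ᵥ N *ᵥ u + 2 * (u ⬝ᵥ b)
      = (u + N⁻¹ *ᵥ b) ⬝ᵥ N *ᵥ (u + N⁻¹ *ᵥ b) - b ⬝ᵥ N⁻¹ *ᵥ b := by
  have hcancel : N *ᵥ N⁻¹ *ᵥ b = b := by rw [mulVec_mulVec, mul_nonsing_inv _ hdet, one_mulVec]
  rw [quadratic_add hN, hcancel, dotProduct_comm (N⁻¹ *ᵥ b) b]
  ring

end QuadraticForms

section RiccatiMap

variable {ι κ 𝕜 : Type*} [Fintype ι] [CommRing 𝕜]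

/-- The weight `R + B' P B` of the input in one step of the linear-quadratic problem with
cost-to-go matrix `P`. -/
def inputWeight (B : Matrix ι κ 𝕜) (R : Matrix κ κ 𝕜) (P : Matrix ι ι 𝕜) : Matrix κ κ 𝕜 :=
  R + Bᵀ * P * B

variable {A Q P : Matrix ι ι 𝕜} {B : Matrix ι κ 𝕜} {R : Matrix κ κ 𝕜}

theorem inputWeight_isSymm (hP : P.IsSymm) (hR : R.IsSymm) : (inputWeight B R P).IsSymm :=
  hR.add (isSymm_transpose_mul_mul hP B)

variable [Fintype κ] [DecidableEq κ]

/-- The gain `K` of the optimal linear feedback `u = -K x` for the cost-to-go matrix `P`. -/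
def riccatiGain (A : Matrix ι ι 𝕜) (B : Matrix ι κ 𝕜) (R : Matrix κ κ 𝕜) (P : Matrix ι ι 𝕜) :
    Matrix κ ι 𝕜 :=
  (inputWeight B R P)⁻¹ * (Bᵀ * P * A)

/-- The system matrix under the feedback with gain `riccatiGain`. -/
def closedLoop (A : Matrix ι ι 𝕜) (B : Matrix ι κ 𝕜) (R : Matrix κ κ 𝕜) (P : Matrix ι ι 𝕜) :
    Matrix ι ι 𝕜 :=
  A - B * riccatiGain A B R P

/-- The right-hand side of the Riccati recursion, as a map of the cost-to-go matrix `P`. -/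
def riccatiMap (A : Matrix ι ι 𝕜) (B : Matrix ι κ 𝕜) (Q : Matrix ι ι 𝕜) (R : Matrix κ κ 𝕜)
    (P : Matrix ι ι 𝕜) : Matrix ι ι 𝕜 :=
  Aᵀ * P * A + Q - Aᵀ * P * B * riccatiGain A B R P

theorem riccatiMap_isSymm (hP : P.IsSymm) (hQ : Q.IsSymm) (hR : R.IsSymm) :
    (riccatiMap A B Q R P).IsSymm := by
  refine ((isSymm_transpose_mul_mul hP A).add hQ).sub ?_
  have h := isSymm_transpose_mul_mul (inputWeight_isSymm hP hR (B := B)).inv (Bᵀ * P * A)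
  simpa only [riccatiGain, transpose_mul, transpose_transpose, hP.eq, Matrix.mul_assoc] using h

theorem closedLoop_transpose (hP : P.IsSymm) (hR : R.IsSymm) :
    (closedLoop A B R P)ᵀ = Aᵀ - Aᵀ * P * B * (inputWeight B R P)⁻¹ * Bᵀ := by
  simp only [closedLoop, riccatiGain, transpose_sub, transpose_mul, transpose_transpose, hP.eq,
    (inputWeight_isSymm hP hR).inv.eq, Matrix.mul_assoc]

theorem riccatiGain_transpose_mul (hP : P.IsSymm) (hR : R.IsSymm) :
    (riccatiGain A B R P)ᵀ * Bᵀ * P * A = Aᵀ * P * B * riccatiGain A B R P := by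
  simp only [riccatiGain, transpose_mul, transpose_transpose, hP.eq,
    (inputWeight_isSymm hP hR).inv.eq, Matrix.mul_assoc]

theorem gain_sub_closedLoop_sub_eq_sub_riccatiMap (hP : P.IsSymm) (hR : R.IsSymm) :
    (B * riccatiGain A B R P)ᵀ * P * (B * riccatiGain A B R P)
        - (closedLoop A B R P)ᵀ * P * closedLoop A B R P - Q
      = Aᵀ * P * B * riccatiGain A B R P - riccatiMap A B Q R P := by
  have hsymm : (riccatiGain A B R P)ᵀ * (Bᵀ * (P * A)) = Aᵀ * (P * (B * riccatiGain A B R P)) := by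
    simpa only [Matrix.mul_assoc] using riccatiGain_transpose_mul hP hR
  simp only [closedLoop, riccatiMap, transpose_sub, transpose_mul, Matrix.sub_mul, Matrix.mul_sub,
    Matrix.mul_assoc, hsymm]
  abel

/-- With the linear term `q` of the cost-to-go as a parameter, this one identity yields both the
Riccati equation for `P` (`q = 0`) and the adjoint equation for the mean of the noise. -/
theorem stage_add_costToGo_eq (hP : P.IsSymm) (hR : R.IsSymm)
    (hdet : IsUnit (inputWeight B R P).det) (x q : ι → 𝕜) (u : κ → 𝕜) :
    x ⬝ᵥ Q *ᵥ x + u ⬝ᵥ R *ᵥ u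
        + (A *ᵥ x + B *ᵥ u) ⬝ᵥ P *ᵥ (A *ᵥ x + B *ᵥ u) + 2 * ((A *ᵥ x + B *ᵥ u) ⬝ᵥ q)
      = x ⬝ᵥ riccatiMap A B Q R P *ᵥ x + 2 * ((closedLoop A B R P *ᵥ x) ⬝ᵥ q)
        + (u + (riccatiGain A B R P *ᵥ x + (inputWeight B R P)⁻¹ *ᵥ Bᵀ *ᵥ q)) ⬝ᵥ
            inputWeight B R P *ᵥ
              (u + (riccatiGain A B R P *ᵥ x + (inputWeight B R P)⁻¹ *ᵥ Bᵀ *ᵥ q))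
        - (Bᵀ *ᵥ q) ⬝ᵥ (inputWeight B R P)⁻¹ *ᵥ (Bᵀ *ᵥ q) := by
  have hΥ : (inputWeight B R P).IsSymm := inputWeight_isSymm hP hR
  have hsq := quadratic_add_linear_eq_completed_square hΥ hdet u ((Bᵀ * P * A) *ᵥ x + Bᵀ *ᵥ q)
  have hgain : (inputWeight B R P)⁻¹ *ᵥ ((Bᵀ * P * A) *ᵥ x + Bᵀ *ᵥ q)
      = riccatiGain A B R P *ᵥ x + (inputWeight B R P)⁻¹ *ᵥ Bᵀ *ᵥ q := by
    rw [mulVec_add, mulVec_mulVec, ← riccatiGain]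
  have hquad : ((Bᵀ * P * A) *ᵥ x) ⬝ᵥ (inputWeight B R P)⁻¹ *ᵥ ((Bᵀ * P * A) *ᵥ x)
      = x ⬝ᵥ (Aᵀ * P * B * riccatiGain A B R P) *ᵥ x := by
    rw [mulVec_dotProduct_mulVec_mulVec]
    simp only [riccatiGain, transpose_mul, transpose_transpose, hP.eq, Matrix.mul_assoc]
  have hlin : (B *ᵥ riccatiGain A B R P *ᵥ x) ⬝ᵥ q
      = ((Bᵀ * P * A) *ᵥ x) ⬝ᵥ (inputWeight B R P)⁻¹ *ᵥ (Bᵀ *ᵥ q) := by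
    rw [mulVec_dotProduct_eq_dotProduct_transpose_mulVec, riccatiGain, ← mulVec_mulVec,
      mulVec_dotProduct_eq_dotProduct_transpose_mulVec, hΥ.inv.eq]
  have hcross : u ⬝ᵥ (Bᵀ * P * A) *ᵥ x = (A *ᵥ x) ⬝ᵥ P *ᵥ (B *ᵥ u) := by
    rw [dotProduct_mulVec_comm_of_isSymm hP, ← mulVec_mulVec, ← mulVec_mulVec,
      ← mulVec_dotProduct_eq_dotProduct_transpose_mulVec]
  have hΥu : u ⬝ᵥ inputWeight B R P *ᵥ u = u ⬝ᵥ R *ᵥ u + (B *ᵥ u) ⬝ᵥ P *ᵥ (B *ᵥ u) := by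
    rw [inputWeight, add_mulVec, dotProduct_add, mulVec_dotProduct_mulVec_mulVec]
  rw [quadratic_add hΥ.inv, hquad, hgain, dotProduct_add, hcross] at hsq
  rw [quadratic_add hP, riccatiMap, closedLoop, sub_mulVec, add_mulVec, sub_mulVec,
    dotProduct_sub, dotProduct_add, ← mulVec_dotProduct_mulVec_mulVec, ← mulVec_mulVec _ B,
    sub_dotProduct, hlin, add_dotProduct, mulVec_dotProduct_eq_dotProduct_transpose_mulVec B u q]
  linear_combination hsq - hΥu

end RiccatiMap

section RealRiccatiMap

variable {ι κ : Type*} {A Q P : Matrix ι ι ℝ} {B : Matrix ι κ ℝ} {R : Matrix κ κ ℝ}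

theorem isSymm_of_posSemidef (hP : P.PosSemidef) : P.IsSymm :=
  isHermitian_iff_isSymm.1 hP.isHermitian

variable [Fintype ι]

theorem quadratic_nonneg (hP : P.PosSemidef) (x : ι → ℝ) : 0 ≤ x ⬝ᵥ P *ᵥ x :=
  hP.dotProduct_mulVec_nonneg x

theorem posSemidef_transpose_mul_mul [Finite κ] (hP : P.PosSemidef) (B : Matrix ι κ ℝ) :
    (Bᵀ * P * B).PosSemidef :=
  hP.conjTranspose_mul_mul_same B

theorem inputWeight_posDef [Finite κ] (hP : P.PosSemidef) (hR : R.PosDef) :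
    (inputWeight B R P).PosDef :=
  hR.add_posSemidef (posSemidef_transpose_mul_mul hP B)

variable [Fintype κ] [DecidableEq κ]

theorem isUnit_det_inputWeight (hP : P.PosSemidef) (hR : R.PosDef) :
    IsUnit (inputWeight B R P).det :=
  (isUnit_iff_isUnit_det _).1 (inputWeight_posDef hP hR).isUnit

theorem riccatiMap_quadratic_eq (hP : P.PosSemidef) (hR : R.PosDef) (x : ι → ℝ) (u : κ → ℝ) :
    x ⬝ᵥ Q *ᵥ x + u ⬝ᵥ R *ᵥ u + (A *ᵥ x + B *ᵥ u) ⬝ᵥ P *ᵥ (A *ᵥ x + B *ᵥ u)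
      = x ⬝ᵥ riccatiMap A B Q R P *ᵥ x
        + (u + riccatiGain A B R P *ᵥ x) ⬝ᵥ inputWeight B R P *ᵥ
            (u + riccatiGain A B R P *ᵥ x) := by
  simpa using stage_add_costToGo_eq (Q := Q) (A := A) (isSymm_of_posSemidef hP)
    (isSymm_of_posSemidef hR.posSemidef) (isUnit_det_inputWeight (B := B) hP hR) x 0 u

theorem riccatiMap_quadratic_le (hP : P.PosSemidef) (hR : R.PosDef) (x : ι → ℝ) (u : κ → ℝ) :
    x ⬝ᵥ riccatiMap A B Q R P *ᵥ x
      ≤ x ⬝ᵥ Q *ᵥ x + u ⬝ᵥ R *ᵥ u + (A *ᵥ x + B *ᵥ u) ⬝ᵥ P *ᵥ (A *ᵥ x + B *ᵥ u) := by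
  rw [riccatiMap_quadratic_eq hP hR]
  exact le_add_of_nonneg_right (quadratic_nonneg (inputWeight_posDef hP hR).posSemidef _)

theorem mulVec_add_mulVec_neg_riccatiGain (x : ι → ℝ) :
    A *ᵥ x + B *ᵥ (-(riccatiGain A B R P *ᵥ x)) = closedLoop A B R P *ᵥ x := by
  rw [closedLoop, sub_mulVec, mulVec_neg, mulVec_mulVec, sub_eq_add_neg]

theorem riccatiMap_quadratic_eq_closedLoop (hP : P.PosSemidef) (hR : R.PosDef) (x : ι → ℝ) :
    x ⬝ᵥ riccatiMap A B Q R P *ᵥ x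
      = x ⬝ᵥ Q *ᵥ x + (riccatiGain A B R P *ᵥ x) ⬝ᵥ R *ᵥ (riccatiGain A B R P *ᵥ x)
        + (closedLoop A B R P *ᵥ x) ⬝ᵥ P *ᵥ (closedLoop A B R P *ᵥ x) := by
  have h := riccatiMap_quadratic_eq (A := A) (B := B) (Q := Q) hP hR x
    (-(riccatiGain A B R P *ᵥ x))
  rw [neg_add_cancel, zero_dotProduct, add_zero, mulVec_add_mulVec_neg_riccatiGain, mulVec_neg,
    neg_dotProduct_neg] at h
  exact h.symm

theorem riccatiMap_posSemidef (hP : P.PosSemidef) (hQ : Q.PosSemidef) (hR : R.PosDef) :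
    (riccatiMap A B Q R P).PosSemidef := by
  refine .of_dotProduct_mulVec_nonneg (isHermitian_iff_isSymm.2 (riccatiMap_isSymm
    (isSymm_of_posSemidef hP) (isSymm_of_posSemidef hQ) (isSymm_of_posSemidef hR.posSemidef)))
    fun x => ?_
  rw [star_trivial, riccatiMap_quadratic_eq_closedLoop hP hR]
  exact add_nonneg (add_nonneg (quadratic_nonneg hQ _) (quadratic_nonneg hR.posSemidef _))
    (quadratic_nonneg hP _)

end RealRiccatiMap

section Recursions

variable {n m M : ℕ} (D : Model n m M)

/-- The standing assumption that the weights of the cost define a linear-quadratic problem: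
`Q(t) ≥ 0`, `R(t) > 0` and `P_{T+1} ≥ 0` for all `t` and `T`. -/
structure WeightsDefinite : Prop where
  state_posSemidef : ∀ t, (D.Q t).PosSemidef
  input_posDef : ∀ t, (D.R t).PosDef
  terminal_posSemidef : ∀ T, (D.Pterm T).PosSemidef

theorem riccati_of_le {T t : ℕ} (h : t ≤ T) :
    riccati D T t = riccatiMap D.A D.B (D.Q t) (D.R t) (riccati D T (t + 1)) := by
  rw [riccati, if_pos h]
  simp only [riccatiMap, riccatiGain, inputWeight, Matrix.mul_assoc]

theorem riccati_terminal (T : ℕ) : riccati D T (T + 1) = D.Pterm T := by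
  rw [riccati, if_neg (by lia)]

theorem adjointL_terminal (T : ℕ) : adjointL D T (T + 1) = 0 := by
  rw [adjointL, if_neg (by lia)]

theorem dMat_eq_transpose_mul_mul (T t : ℕ) :
    dMat D T t = (D.Bᵀ * (riccati D T (t + 1) + adjointL D T (t + 1)))ᵀ * (upsilon D T t)⁻¹
      * (D.Bᵀ * (riccati D T (t + 1) + adjointL D T (t + 1))) := by
  simp only [dMat, transpose_mul, transpose_transpose, Matrix.mul_assoc]

variable {D}

namespace WeightsDefinite

variable (hD : WeightsDefinite D)
include hD

theorem riccati_posSemidef (T t : ℕ) : (riccati D T t).PosSemidef := by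
  by_cases h : t ≤ T + 1
  · induction h using Nat.decreasingInduction with
    | self => exact riccati_terminal D T ▸ hD.terminal_posSemidef T
    | of_succ k hk ih =>
      rw [riccati_of_le D (Nat.lt_succ_iff.1 hk)]
      exact riccatiMap_posSemidef ih (hD.state_posSemidef k) (hD.input_posDef k)
  · rw [riccati, if_neg (by lia)]
    exact hD.terminal_posSemidef T

theorem riccati_isSymm (T t : ℕ) : (riccati D T t).IsSymm :=
  isSymm_of_posSemidef (hD.riccati_posSemidef T t)

theorem input_isSymm (t : ℕ) : (D.R t).IsSymm :=
  isSymm_of_posSemidef (hD.input_posDef t).posSemidef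

theorem upsilon_posDef (T t : ℕ) : (upsilon D T t).PosDef :=
  inputWeight_posDef (hD.riccati_posSemidef T (t + 1)) (hD.input_posDef t)

theorem adjointL_of_le {T t : ℕ} (h : t ≤ T) :
    adjointL D T t = (closedLoop D.A D.B (D.R t) (riccati D T (t + 1)))ᵀ
      * (riccati D T (t + 1) + adjointL D T (t + 1)) := by
  rw [adjointL, if_pos h, closedLoop_transpose (hD.riccati_isSymm T _) (hD.input_isSymm t)]
  rfl

theorem dMat_posSemidef (T t : ℕ) : (dMat D T t).PosSemidef := by
  rw [dMat_eq_transpose_mul_mul]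
  exact posSemidef_transpose_mul_mul (hD.upsilon_posDef T t).inv.posSemidef _

theorem bellman_feedback {T t : ℕ} (h : t ≤ T) (x μ ν : Fin n → ℝ) :
    x ⬝ᵥ D.Q t *ᵥ x + feedback D T t x ν ⬝ᵥ D.R t *ᵥ feedback D T t x ν
        + (D.A *ᵥ x + D.B *ᵥ feedback D T t x ν) ⬝ᵥ riccati D T (t + 1) *ᵥ
            (D.A *ᵥ x + D.B *ᵥ feedback D T t x ν)
        + 2 * ((D.A *ᵥ x + D.B *ᵥ feedback D T t x ν) ⬝ᵥ
            (riccati D T (t + 1) + adjointL D T (t + 1)) *ᵥ μ)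
      = x ⬝ᵥ riccati D T t *ᵥ x + 2 * (x ⬝ᵥ adjointL D T t *ᵥ μ)
        + (μ - ν) ⬝ᵥ dMat D T t *ᵥ (μ - ν) - μ ⬝ᵥ dMat D T t *ᵥ μ := by
  have hsq := stage_add_costToGo_eq (A := D.A) (B := D.B) (Q := D.Q t) (hD.riccati_isSymm T (t + 1))
    (hD.input_isSymm t)
    (isUnit_det_inputWeight (hD.riccati_posSemidef T (t + 1)) (hD.input_posDef t)) x
    ((riccati D T (t + 1) + adjointL D T (t + 1)) *ᵥ μ) (feedback D T t x ν)
  have hΥ : inputWeight D.B (D.R t) (riccati D T (t + 1)) = upsilon D T t := rfl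
  have hΥdet : IsUnit (upsilon D T t).det :=
    isUnit_det_inputWeight (hD.riccati_posSemidef T (t + 1)) (hD.input_posDef t)
  have hdev : feedback D T t x ν
        + (riccatiGain D.A D.B (D.R t) (riccati D T (t + 1)) *ᵥ x + (upsilon D T t)⁻¹ *ᵥ D.Bᵀ *ᵥ
            (riccati D T (t + 1) + adjointL D T (t + 1)) *ᵥ μ)
      = (upsilon D T t)⁻¹ *ᵥ
          ((D.Bᵀ * (riccati D T (t + 1) + adjointL D T (t + 1))) *ᵥ (μ - ν)) := by
    simp only [feedback, riccatiGain, hΥ, mulVec_sub, mulVec_add, mulVec_mulVec, Matrix.mul_add,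
      add_mulVec]
    abel
  have hquad : ∀ z, ((D.Bᵀ * (riccati D T (t + 1) + adjointL D T (t + 1))) *ᵥ z) ⬝ᵥ
      (upsilon D T t)⁻¹ *ᵥ ((D.Bᵀ * (riccati D T (t + 1) + adjointL D T (t + 1))) *ᵥ z)
        = z ⬝ᵥ dMat D T t *ᵥ z := fun z => by
    rw [dMat_eq_transpose_mul_mul, mulVec_dotProduct_mulVec_mulVec]
  rw [hΥ, hdev, mulVec_mulVec _ (upsilon D T t), mul_nonsing_inv _ hΥdet, one_mulVec,
    dotProduct_comm (_ *ᵥ _) (_ *ᵥ (μ - ν)), hquad, mulVec_mulVec μ, hquad,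
    mulVec_dotProduct_eq_dotProduct_transpose_mulVec (closedLoop _ _ _ _), mulVec_mulVec,
    ← hD.adjointL_of_le h, ← riccati_of_le D h] at hsq
  exact hsq

end WeightsDefinite

end Recursions

section Expectation

variable {Ω : Type*} [MeasurableSpace Ω] {P : Measure Ω}

/-- `f` is integrable with expectation `a`; stating the two together keeps the junk value `0` of
the integral of a non-integrable function out of the expectation calculus. -/
structure HasExpectation (P : Measure Ω) (f : Ω → ℝ) (a : ℝ) : Prop where
  integrable : Integrable f P
  integral_eq : ∫ ω, f ω ∂P = a

theorem hasExpectation_integral {f : Ω → ℝ} (hf : Integrable f P) :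
    HasExpectation P f (∫ ω, f ω ∂P) :=
  ⟨hf, rfl⟩

namespace HasExpectation

variable {f g : Ω → ℝ} {a b : ℝ}

theorem add (hf : HasExpectation P f a) (hg : HasExpectation P g b) :
    HasExpectation P (fun ω => f ω + g ω) (a + b) :=
  ⟨hf.integrable.add hg.integrable, by
    rw [integral_add hf.integrable hg.integrable, hf.integral_eq, hg.integral_eq]⟩

theorem sub (hf : HasExpectation P f a) (hg : HasExpectation P g b) :
    HasExpectation P (fun ω => f ω - g ω) (a - b) :=
  ⟨hf.integrable.sub hg.integrable, by
    rw [integral_sub hf.integrable hg.integrable, hf.integral_eq, hg.integral_eq]⟩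

theorem const_mul (c : ℝ) (hf : HasExpectation P f a) :
    HasExpectation P (fun ω => c * f ω) (c * a) :=
  ⟨hf.integrable.const_mul c, by rw [integral_const_mul, hf.integral_eq]⟩

theorem const [IsProbabilityMeasure P] (c : ℝ) : HasExpectation P (fun _ => c) c :=
  ⟨integrable_const c, by simp⟩

theorem sum {ι : Type*} {s : Finset ι} {f : ι → Ω → ℝ} {a : ι → ℝ}
    (h : ∀ i ∈ s, HasExpectation P (f i) (a i)) :
    HasExpectation P (fun ω => ∑ i ∈ s, f i ω) (∑ i ∈ s, a i) :=
  ⟨integrable_finsetSum _ fun i hi => (h i hi).integrable, by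
    rw [integral_finsetSum _ fun i hi => (h i hi).integrable]
    exact Finset.sum_congr rfl fun i hi => (h i hi).integral_eq⟩

end HasExpectation

end Expectation

section RandomVectors

variable {Ω ι κ : Type*} [MeasurableSpace Ω] {P : Measure Ω} [Fintype κ]

theorem measurable_mulVec (N : Matrix ι κ ℝ) : Measurable fun z : κ → ℝ => N *ᵥ z :=
  measurable_pi_lambda _ fun i => Continuous.measurable (by fun_prop)

variable [Fintype ι]

theorem memLp_mulVec (N : Matrix ι κ ℝ) {X : Ω → κ → ℝ} (hX : MemLp X 2 P) :
    MemLp (fun ω => N *ᵥ X ω) 2 P :=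
  N.mulVecLin.toContinuousLinearMap.comp_memLp' hX

theorem integral_mulVec [IsFiniteMeasure P] (N : Matrix ι κ ℝ) {X : Ω → κ → ℝ}
    (hX : MemLp X 2 P) : ∫ ω, N *ᵥ X ω ∂P = N *ᵥ ∫ ω, X ω ∂P :=
  N.mulVecLin.toContinuousLinearMap.integral_comp_comm (hX.integrable one_le_two)

theorem integrable_dotProduct {X Y : Ω → ι → ℝ} (hX : MemLp X 2 P) (hY : MemLp Y 2 P) :
    Integrable (fun ω => X ω ⬝ᵥ Y ω) P :=
  integrable_finsetSum _ fun i _ => (hX.eval i).integrable_mul (hY.eval i)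

theorem integrable_quadratic (N : Matrix ι ι ℝ) {X : Ω → ι → ℝ} (hX : MemLp X 2 P) :
    Integrable (fun ω => X ω ⬝ᵥ N *ᵥ X ω) P :=
  integrable_dotProduct hX (memLp_mulVec N hX)

variable [IsProbabilityMeasure P]

theorem hasExpectation_dotProduct_of_indepFun {X Y : Ω → ι → ℝ} (hX : MemLp X 2 P)
    (hY : MemLp Y 2 P) (h : IndepFun X Y P) :
    HasExpectation P (fun ω => X ω ⬝ᵥ Y ω) ((∫ ω, X ω ∂P) ⬝ᵥ ∫ ω, Y ω ∂P) := by
  refine HasExpectation.sum fun i _ => ⟨(hX.eval i).integrable_mul (hY.eval i), ?_⟩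
  have hi : IndepFun (fun ω => X ω i) (fun ω => Y ω i) P :=
    h.comp (measurable_pi_apply i) (measurable_pi_apply i)
  rw [eval_integral fun i => (hX.eval i).integrable one_le_two,
    eval_integral fun i => (hY.eval i).integrable one_le_two]
  exact hi.integral_fun_mul_eq_mul_integral (hX.eval i).aestronglyMeasurable
    (hY.eval i).aestronglyMeasurable

theorem hasExpectation_dotProduct_const {X : Ω → ι → ℝ} (hX : MemLp X 2 P) (z : ι → ℝ) :
    HasExpectation P (fun ω => X ω ⬝ᵥ z) ((∫ ω, X ω ∂P) ⬝ᵥ z) := by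
  simpa using hasExpectation_dotProduct_of_indepFun hX (memLp_const z) (indepFun_const_right X z)

theorem hasExpectation_bilinear_of_indepFun (N : Matrix ι κ ℝ) {X : Ω → ι → ℝ} {Y : Ω → κ → ℝ}
    (hX : MemLp X 2 P) (hY : MemLp Y 2 P) (h : IndepFun X Y P) :
    HasExpectation P (fun ω => X ω ⬝ᵥ N *ᵥ Y ω) ((∫ ω, X ω ∂P) ⬝ᵥ N *ᵥ ∫ ω, Y ω ∂P) := by
  rw [← integral_mulVec N hY]
  exact hasExpectation_dotProduct_of_indepFun hX (memLp_mulVec N hY)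
    (h.comp measurable_id (measurable_mulVec N))

end RandomVectors

section QuadraticExpectation

variable {Ω : Type*} {n : ℕ} [MeasurableSpace Ω] {P : Measure Ω} {N : Matrix (Fin n) (Fin n) ℝ}
  {X Y : Ω → Fin n → ℝ} {a : ℝ}

theorem hasExpectation_quadratic (N : Matrix (Fin n) (Fin n) ℝ) (hX : MemLp X 2 P) :
    HasExpectation P (fun ω => X ω ⬝ᵥ N *ᵥ X ω) (N * momentMatrix P X).trace := by
  have hentry : ∀ i j, HasExpectation P (fun ω => N i j * (X ω j * X ω i))
      (N i j * momentMatrix P X j i) := fun i j =>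
    HasExpectation.const_mul _ ⟨(hX.eval j).integrable_mul (hX.eval i), rfl⟩
  have hsum : (fun ω => X ω ⬝ᵥ N *ᵥ X ω) = fun ω => ∑ i, ∑ j, N i j * (X ω j * X ω i) := by
    funext ω
    simp only [dotProduct, mulVec, Finset.mul_sum]
    exact Finset.sum_congr rfl fun i _ => Finset.sum_congr rfl fun j _ => by ring
  rw [hsum]
  exact HasExpectation.sum fun i _ => HasExpectation.sum fun j _ => hentry i j

theorem momentMatrix_mulVec {k : ℕ} (F : Matrix (Fin k) (Fin n) ℝ) (hX : MemLp X 2 P) :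
    momentMatrix P (fun ω => F *ᵥ X ω) = F * momentMatrix P X * Fᵀ := by
  ext i j
  have h := (hasExpectation_quadratic (Fᵀ * single j i (1 : ℝ) * F) hX).integral_eq
  rw [← trace_mul_mul_mul_transpose, trace_single_mul, one_smul] at h
  have hentry : ∀ z : Fin k → ℝ, z ⬝ᵥ single j i (1 : ℝ) *ᵥ z = z i * z j := fun z => by
    rw [single_mulVec, one_mul]
    exact (dotProduct_single _ _ _).trans (mul_comm _ _)
  simp only [← mulVec_dotProduct_mulVec_mulVec, hentry] at h
  exact h

theorem momentMatrix_smul (c : ℝ) (X : Ω → Fin n → ℝ) :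
    momentMatrix P (fun ω => c • X ω) = c ^ 2 • momentMatrix P X := by
  ext i j
  simp only [momentMatrix, of_apply, Matrix.smul_apply, Pi.smul_apply, smul_eq_mul]
  rw [← integral_const_mul]
  exact integral_congr_ae (ae_of_all _ fun ω => by ring)

variable [IsProbabilityMeasure P]

theorem hasExpectation_quadratic_add (hN : N.IsSymm) (hX : MemLp X 2 P) (hY : MemLp Y 2 P)
    (h : IndepFun X Y P) (ha : HasExpectation P (fun ω => X ω ⬝ᵥ N *ᵥ X ω) a) :
    HasExpectation P (fun ω => (X ω + Y ω) ⬝ᵥ N *ᵥ (X ω + Y ω))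
      (a + 2 * ((∫ ω, X ω ∂P) ⬝ᵥ N *ᵥ ∫ ω, Y ω ∂P) + (N * momentMatrix P Y).trace) := by
  simp only [quadratic_add hN]
  exact (ha.add ((hasExpectation_bilinear_of_indepFun N hX hY h).const_mul 2)).add
    (hasExpectation_quadratic N hY)

theorem hasExpectation_quadratic_add_of_integral_eq_zero (hN : N.IsSymm) (hX : MemLp X 2 P)
    (hY : MemLp Y 2 P) (h : IndepFun X Y P) (hY0 : ∫ ω, Y ω ∂P = 0)
    (ha : HasExpectation P (fun ω => X ω ⬝ᵥ N *ᵥ X ω) a) :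
    HasExpectation P (fun ω => (X ω + Y ω) ⬝ᵥ N *ᵥ (X ω + Y ω))
      (a + (N * momentMatrix P Y).trace) := by
  simpa [hY0] using hasExpectation_quadratic_add hN hX hY h ha

theorem hasExpectation_quadratic_add_mulVec {k : ℕ} {Y : Ω → Fin k → ℝ} (hN : N.IsSymm)
    (F : Matrix (Fin n) (Fin k) ℝ) (hX : MemLp X 2 P) (hY : MemLp Y 2 P) (h : IndepFun X Y P)
    (hY0 : ∫ ω, Y ω ∂P = 0) (ha : HasExpectation P (fun ω => X ω ⬝ᵥ N *ᵥ X ω) a) :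
    HasExpectation P (fun ω => (X ω + F *ᵥ Y ω) ⬝ᵥ N *ᵥ (X ω + F *ᵥ Y ω))
      (a + (Fᵀ * N * F * momentMatrix P Y).trace) := by
  have hFY : ∫ ω, F *ᵥ Y ω ∂P = 0 := by rw [integral_mulVec F hY, hY0, mulVec_zero]
  rw [← trace_mul_mul_mul_transpose, ← momentMatrix_mulVec F hY]
  exact hasExpectation_quadratic_add_of_integral_eq_zero hN hX (memLp_mulVec F hY)
    (h.comp measurable_id (measurable_mulVec F)) hFY ha

theorem momentMatrix_sub_integral (hX : MemLp X 2 P) :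
    momentMatrix P (fun ω => X ω - ∫ ω, X ω ∂P)
      = momentMatrix P X - vecMulVec (∫ ω, X ω ∂P) (∫ ω, X ω ∂P) := by
  ext i j
  have heval (k : Fin n) : (∫ ω, X ω ∂P) k = ∫ ω, X ω k ∂P :=
    eval_integral (fun k => (hX.eval k).integrable one_le_two) k
  simpa only [momentMatrix, Matrix.sub_apply, of_apply, vecMulVec_apply, heval, Pi.sub_apply,
    Pi.mul_apply, ProbabilityTheory.covariance] using covariance_eq_sub (hX.eval i) (hX.eval j)

theorem momentMatrix_sum {ι : Type*} {s : Finset ι} {X : ι → Ω → Fin n → ℝ}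
    (hX : ∀ i ∈ s, MemLp (X i) 2 P) (hX0 : ∀ i ∈ s, ∫ ω, X i ω ∂P = 0)
    (hindep : Set.Pairwise s fun i j => IndepFun (X i) (X j) P) :
    momentMatrix P (fun ω => ∑ i ∈ s, X i ω) = ∑ i ∈ s, momentMatrix P (X i) := by
  classical
  ext k l
  have hprod (i) (hi : i ∈ s) (j) (hj : j ∈ s) : HasExpectation P (fun ω => X i ω k * X j ω l)
      (if i = j then momentMatrix P (X i) k l else 0) := by
    refine ⟨((hX i hi).eval k).integrable_mul ((hX j hj).eval l), ?_⟩
    split_ifs with hij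
    · subst hij; rfl
    · have hind : IndepFun (fun ω => X i ω k) (fun ω => X j ω l) P :=
        (hindep hi hj hij).comp (measurable_pi_apply k) (measurable_pi_apply l)
      have hzero : ∫ ω, X i ω k ∂P = 0 := by
        rw [← eval_integral fun k => ((hX i hi).eval k).integrable one_le_two, hX0 i hi,
          Pi.zero_apply]
      rw [hind.integral_fun_mul_eq_mul_integral ((hX i hi).eval k).aestronglyMeasurable
        ((hX j hj).eval l).aestronglyMeasurable, hzero, zero_mul]
  have hsum := (HasExpectation.sum fun i hi =>
    HasExpectation.sum fun j hj => hprod i hi j hj).integral_eq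
  simp only [momentMatrix, of_apply, Finset.sum_apply, Finset.sum_mul_sum, Matrix.sum_apply]
  rw [hsum]
  exact Finset.sum_congr rfl fun i hi => by rw [Finset.sum_ite_eq, if_pos hi]; rfl

end QuadraticExpectation

theorem norm_le_vecNorm {n : ℕ} (z : Fin n → ℝ) : ‖z‖ ≤ vecNorm z :=
  (pi_norm_le_iff_of_nonneg (norm_nonneg _)).2 fun i => PiLp.norm_apply_le (WithLp.toLp 2 z) i

section Independence

variable {Ω ι E F : Type*} [MeasurableSpace Ω] [MeasurableSpace E] [MeasurableSpace F]
  {P : Measure Ω}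

theorem indepFun_of_measurable_biSup_comap {f : ι → Ω → E} (hf : iIndepFun f P)
    (hmeas : ∀ i, Measurable (f i)) {S : Set ι} {X : Ω → F}
    (hX : Measurable[⨆ j ∈ S, MeasurableSpace.comap (f j) inferInstance] X) {i : ι} (hi : i ∉ S) :
    IndepFun X (f i) P := by
  rw [IndepFun_iff_Indep]
  have hpast := indep_iSup_of_disjoint (fun j => (hmeas j).comap_le) hf.iIndep
    (Set.disjoint_singleton_right.2 hi)
  rw [iSup_singleton] at hpast
  exact indep_of_indep_of_le_left hpast hX.comap_le

end Independence

section Past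

variable {Ω E : Type*} [MeasurableSpace E] (x₀ : Ω → E) (w v : ℕ → Ω → E)

/-- The σ-algebra generated by `x₀`, `w(0), …, w(a-1)` and `v(0), …, v(b-1)`. -/
abbrev past (a b : ℕ) : MeasurableSpace Ω :=
  ⨆ i ∈ {i | Sum.elim (fun _ : Unit => True) (Sum.elim (· < a) (· < b)) i},
    MeasurableSpace.comap (Sum.elim (fun _ : Unit => x₀) (Sum.elim w v) i) inferInstance

theorem past_mono {a b a' b' : ℕ} (ha : a ≤ a') (hb : b ≤ b') :
    past x₀ w v a b ≤ past x₀ w v a' b' := by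
  refine biSup_mono ?_
  rintro (_ | i | i) hi
  · exact hi
  · exact lt_of_lt_of_le (b := a) hi ha
  · exact lt_of_lt_of_le (b := b) hi hb

theorem measurable_past {a b : ℕ} {i : Unit ⊕ ℕ ⊕ ℕ}
    (hi : Sum.elim (fun _ => True) (Sum.elim (· < a) (· < b)) i) :
    Measurable[past x₀ w v a b] (Sum.elim (fun _ : Unit => x₀) (Sum.elim w v) i) :=
  measurable_iff_comap_le.2 (le_biSup (fun i => MeasurableSpace.comap
    (Sum.elim (fun _ : Unit => x₀) (Sum.elim w v) i) inferInstance) hi)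

theorem measurable_past_init (a b : ℕ) : Measurable[past x₀ w v a b] x₀ :=
  measurable_past x₀ w v (i := Sum.inl ()) trivial

theorem measurable_past_w {s a : ℕ} (hs : s < a) (b : ℕ) : Measurable[past x₀ w v a b] (w s) :=
  measurable_past x₀ w v (i := Sum.inr (Sum.inl s)) hs

theorem measurable_past_v {s b : ℕ} (a : ℕ) (hs : s < b) : Measurable[past x₀ w v a b] (v s) :=
  measurable_past x₀ w v (i := Sum.inr (Sum.inr s)) hs

end Past

section Noise

variable {n m M : ℕ} {Ω : Type*} [MeasurableSpace Ω] {P : Measure Ω}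

/-- The standing assumptions on the initial state, the system noise and the measurement noise. Of
the Gaussian law of `x₀`, only the finiteness of the second moments is kept. -/
structure NoiseModel (P : Measure Ω) (D : Model n m M) (p : Fin M → ℝ) (x₀ : Ω → Fin n → ℝ)
    (w v : ℕ → Ω → Fin n → ℝ) (v_b : ℝ) : Prop where
  mem_stdSimplex : p ∈ stdSimplex ℝ (Fin M)
  measurable_init : Measurable x₀
  memLp_init : MemLp x₀ 2 P
  measurable_w : ∀ t, Measurable (w t)
  map_w : ∀ t, P.map (w t) = ∑ i, ENNReal.ofReal (p i) • Measure.dirac (D.atom i)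
  measurable_v : ∀ t, Measurable (v t)
  identDistrib_v : ∀ t, IdentDistrib (v t) (v 0) P P
  ae_vecNorm_v_le : ∀ t, ∀ᵐ ω ∂P, vecNorm (v t ω) ≤ v_b
  integral_v_zero : ∫ ω, v 0 ω ∂P = 0
  iIndepFun : iIndepFun (Sum.elim (fun _ : Unit => x₀) (Sum.elim w v)) P

namespace NoiseModel

variable {D : Model n m M} {p : Fin M → ℝ} {x₀ : Ω → Fin n → ℝ} {w v : ℕ → Ω → Fin n → ℝ}
  {v_b : ℝ} (h : NoiseModel P D p x₀ w v v_b)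
include h

theorem ae_w_mem_range_atom (t : ℕ) : ∀ᵐ ω ∂P, w t ω ∈ Set.range D.atom := by
  have hs : MeasurableSet (Set.range D.atom) := (Set.finite_range _).measurableSet
  refine (ae_map_iff (h.measurable_w t).aemeasurable hs).1 ?_
  rw [h.map_w t, ae_finsetSum_measure_iff]
  exact fun i _ => Measure.ae_smul_measure ((ae_dirac_iff hs).2 (Set.mem_range_self i)) _

theorem hasExpectation_comp_w (t : ℕ) {f : (Fin n → ℝ) → ℝ} (hf : Measurable f) :
    HasExpectation P (fun ω => f (w t ω)) (∑ i, p i * f (D.atom i)) := by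
  have hatom : ∀ i ∈ Finset.univ, Integrable f
      (ENNReal.ofReal (p i) • Measure.dirac (D.atom i)) := fun i _ =>
    (integrable_dirac (by simp)).smul_measure (by simp)
  have hmap : Integrable f (P.map (w t)) := by
    rw [h.map_w t]
    exact integrable_finsetSum_measure.2 hatom
  refine ⟨(integrable_map_measure hf.aestronglyMeasurable (h.measurable_w t).aemeasurable).1 hmap,
    ?_⟩
  rw [← integral_map (h.measurable_w t).aemeasurable hf.aestronglyMeasurable, h.map_w t,
    integral_finsetSum_measure hatom]
  refine Finset.sum_congr rfl fun i _ => ?_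
  rw [integral_smul_measure, integral_dirac, ENNReal.toReal_ofReal (h.mem_stdSimplex.1 i),
    smul_eq_mul]

theorem momentMatrix_w (t : ℕ) : momentMatrix P (w t) = secondMoment D.atom p := by
  ext i j
  have hij := (h.hasExpectation_comp_w t
    ((measurable_pi_apply i).mul (measurable_pi_apply j))).integral_eq
  simpa [momentMatrix, secondMoment, Matrix.sum_apply, vecMulVec_apply] using hij

theorem integral_v (t : ℕ) : ∫ ω, v t ω ∂P = 0 := by
  rw [(h.identDistrib_v t).integral_eq, h.integral_v_zero]

theorem momentMatrix_v (t : ℕ) : momentMatrix P (v t) = momentMatrix P (v 0) := by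
  ext i j
  exact ((h.identDistrib_v t).comp
    ((measurable_pi_apply i).mul (measurable_pi_apply j))).integral_eq

variable {a b t : ℕ}

theorem indepFun_past {E : Type*} [MeasurableSpace E] {X : Ω → E}
    (hX : Measurable[past x₀ w v a b] X) {i : Unit ⊕ ℕ ⊕ ℕ}
    (hi : ¬ Sum.elim (fun _ => True) (Sum.elim (· < a) (· < b)) i) :
    IndepFun X (Sum.elim (fun _ : Unit => x₀) (Sum.elim w v) i) P := by
  refine indepFun_of_measurable_biSup_comap h.iIndepFun ?_ hX hi
  rintro (_ | i | i)
  exacts [h.measurable_init, h.measurable_w i, h.measurable_v i]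

theorem indepFun_w {E : Type*} [MeasurableSpace E] {X : Ω → E}
    (hX : Measurable[past x₀ w v t b] X) : IndepFun X (w t) P :=
  h.indepFun_past hX (i := Sum.inr (Sum.inl t)) (lt_irrefl t)

theorem indepFun_v {E : Type*} [MeasurableSpace E] {X : Ω → E}
    (hX : Measurable[past x₀ w v a t] X) : IndepFun X (v t) P :=
  h.indepFun_past hX (i := Sum.inr (Sum.inr t)) (lt_irrefl t)

variable [IsFiniteMeasure P]

theorem memLp_w (t : ℕ) : MemLp (w t) 2 P := by
  refine MemLp.of_bound (h.measurable_w t).aestronglyMeasurable (∑ i, ‖D.atom i‖) ?_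
  filter_upwards [h.ae_w_mem_range_atom t] with ω ⟨i, hi⟩
  rw [← hi]
  exact Finset.single_le_sum (f := fun i => ‖D.atom i‖) (fun _ _ => norm_nonneg _)
    (Finset.mem_univ i)

theorem memLp_v (t : ℕ) : MemLp (v t) 2 P := by
  refine MemLp.of_bound (h.measurable_v t).aestronglyMeasurable v_b ?_
  filter_upwards [h.ae_vecNorm_v_le t] with ω hω using (norm_le_vecNorm _).trans hω

theorem integral_mulVec_v {k : ℕ} (F : Matrix (Fin k) (Fin n) ℝ) (t : ℕ) :
    ∫ ω, F *ᵥ v t ω ∂P = 0 := by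
  rw [integral_mulVec F (h.memLp_v t), h.integral_v, mulVec_zero]

theorem momentMatrix_mulVec_v {k : ℕ} (F : Matrix (Fin k) (Fin n) ℝ) (t : ℕ) :
    momentMatrix P (fun ω => F *ᵥ v t ω) = F * momentMatrix P (v 0) * Fᵀ := by
  rw [momentMatrix_mulVec F (h.memLp_v t), h.momentMatrix_v]

theorem integral_w (t : ℕ) : ∫ ω, w t ω ∂P = meanOf D.atom p := by
  ext i
  rw [eval_integral fun i => ((h.memLp_w t).eval i).integrable one_le_two,
    (h.hasExpectation_comp_w t (measurable_pi_apply i)).integral_eq]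
  simp [meanOf]

end NoiseModel

end Noise

section OneStep

variable {n m M : ℕ} {D : Model n m M} {T t : ℕ}

theorem feedback_add (x e ν : Fin n → ℝ) :
    feedback D T t (x + e) ν
      = feedback D T t x ν - riccatiGain D.A D.B (D.R t) (riccati D T (t + 1)) *ᵥ e := by
  have hΥ : inputWeight D.B (D.R t) (riccati D T (t + 1)) = upsilon D T t := rfl
  simp only [feedback, riccatiGain, hΥ, mulVec_add, mulVec_mulVec]
  abel

theorem WeightsDefinite.trace_gain_sub_closedLoop (hD : WeightsDefinite D)
    (ht : t ≤ T) (S : Matrix (Fin n) (Fin n) ℝ) :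
    ((D.B * riccatiGain D.A D.B (D.R t) (riccati D T (t + 1)))ᵀ * riccati D T (t + 1)
          * (D.B * riccatiGain D.A D.B (D.R t) (riccati D T (t + 1))) * S).trace
        - ((closedLoop D.A D.B (D.R t) (riccati D T (t + 1)))ᵀ * riccati D T (t + 1)
          * closedLoop D.A D.B (D.R t) (riccati D T (t + 1)) * S).trace - (D.Q t * S).trace
      = (D.Aᵀ * riccati D T (t + 1) * D.B * (upsilon D T t)⁻¹ * D.Bᵀ * riccati D T (t + 1) * D.A
          * S).trace - (riccati D T t * S).trace := by
  have hgain : D.Aᵀ * riccati D T (t + 1) * D.B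
        * riccatiGain D.A D.B (D.R t) (riccati D T (t + 1))
      = D.Aᵀ * riccati D T (t + 1) * D.B * (upsilon D T t)⁻¹ * D.Bᵀ * riccati D T (t + 1)
        * D.A := by
    simp only [riccatiGain, upsilon, inputWeight, Matrix.mul_assoc]
  rw [← trace_sub, ← trace_sub, ← trace_sub, ← Matrix.sub_mul, ← Matrix.sub_mul, ← Matrix.sub_mul,
    gain_sub_closedLoop_sub_eq_sub_riccatiMap (hD.riccati_isSymm T (t + 1)) (hD.input_isSymm t),
    ← riccati_of_le D ht, hgain]

/-- The value function `x' P_T(t) x + 2 x' L_T(t) μ` of the certainty-equivalent problem, up to an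
additive constant. -/
def costToGo (D : Model n m M) (T t : ℕ) (μ x : Fin n → ℝ) : ℝ :=
  x ⬝ᵥ riccati D T t *ᵥ x + 2 * (x ⬝ᵥ adjointL D T t *ᵥ μ)

variable {Ω : Type*} [MeasurableSpace Ω] {P : Measure Ω} {x e w e' ν : Ω → Fin n → ℝ}

theorem memLp_feedback (hx : MemLp x 2 P) (hν : MemLp ν 2 P) :
    MemLp (fun ω => feedback D T t (x ω) (ν ω)) 2 P := by
  have hx' := memLp_mulVec (D.Bᵀ * riccati D T (t + 1) * D.A) hx
  have hν' := memLp_mulVec (D.Bᵀ * riccati D T (t + 1)) hν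
  have hν'' := memLp_mulVec (D.Bᵀ * adjointL D T (t + 1)) hν
  exact (memLp_mulVec (upsilon D T t)⁻¹ ((hx'.add hν').add hν'')).neg

variable [IsProbabilityMeasure P]

theorem integrable_costToGo (hx : MemLp x 2 P) (μ : Fin n → ℝ) :
    Integrable (fun ω => costToGo D T t μ (x ω)) P :=
  (integrable_quadratic _ hx).add ((integrable_dotProduct hx (memLp_const _)).const_mul 2)

namespace WeightsDefinite

variable (hD : WeightsDefinite D)
include hD

theorem integral_costToGo_add_noises {z : Ω → Fin n → ℝ} (hz : MemLp z 2 P) (hw : MemLp w 2 P)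
    (he' : MemLp e' 2 P) (hzw : IndepFun z w P) (hzwe : IndepFun (fun ω => z ω + w ω) e' P)
    (he'_zero : ∫ ω, e' ω ∂P = 0) :
    ∫ ω, costToGo D T t (∫ ω, w ω ∂P) (z ω + w ω + e' ω) ∂P
      = (∫ ω, z ω ⬝ᵥ riccati D T t *ᵥ z ω ∂P)
        + 2 * ((∫ ω, z ω ∂P) ⬝ᵥ (riccati D T t + adjointL D T t) *ᵥ ∫ ω, w ω ∂P)
        + 2 * ((∫ ω, w ω ∂P) ⬝ᵥ adjointL D T t *ᵥ ∫ ω, w ω ∂P)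
        + (riccati D T t * momentMatrix P w).trace + (riccati D T t * momentMatrix P e').trace := by
  have hP := hD.riccati_isSymm T t
  have hmean : ∫ ω, z ω + w ω + e' ω ∂P = ∫ ω, z ω ∂P + ∫ ω, w ω ∂P := by
    rw [integral_add (f := fun ω => z ω + w ω) ((hz.add hw).integrable one_le_two)
      (he'.integrable one_le_two), he'_zero, add_zero,
      integral_add (hz.integrable one_le_two) (hw.integrable one_le_two)]
  have hquad := hasExpectation_quadratic_add_of_integral_eq_zero hP (hz.add hw) he' hzwe he'_zero
    (hasExpectation_quadratic_add hP hz hw hzw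
      (hasExpectation_integral (integrable_quadratic _ hz)))
  have hlin := hasExpectation_dotProduct_const ((hz.add hw).add he')
    (adjointL D T t *ᵥ ∫ ω, w ω ∂P)
  refine (hquad.add (hlin.const_mul 2)).integral_eq.trans ?_
  rw [show ∫ ω, (z + w + e') ω ∂P = _ from hmean, add_dotProduct, add_mulVec, dotProduct_add]
  ring

theorem integral_bellman_feedback (ht : t ≤ T) (hx : MemLp x 2 P) (hν : MemLp ν 2 P)
    (μ : Fin n → ℝ) :
    (∫ ω, x ω ⬝ᵥ D.Q t *ᵥ x ω ∂P)
        + (∫ ω, feedback D T t (x ω) (ν ω) ⬝ᵥ D.R t *ᵥ feedback D T t (x ω) (ν ω) ∂P)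
        + (∫ ω, (D.A *ᵥ x ω + D.B *ᵥ feedback D T t (x ω) (ν ω)) ⬝ᵥ riccati D T (t + 1) *ᵥ
            (D.A *ᵥ x ω + D.B *ᵥ feedback D T t (x ω) (ν ω)) ∂P)
        + 2 * ((∫ ω, D.A *ᵥ x ω + D.B *ᵥ feedback D T t (x ω) (ν ω) ∂P) ⬝ᵥ
            (riccati D T (t + 1) + adjointL D T (t + 1)) *ᵥ μ)
      = (∫ ω, costToGo D T t μ (x ω) ∂P)
        + (∫ ω, (μ - ν ω) ⬝ᵥ dMat D T t *ᵥ (μ - ν ω) ∂P) - μ ⬝ᵥ dMat D T t *ᵥ μ := by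
  have hu : MemLp (fun ω => feedback D T t (x ω) (ν ω)) 2 P := memLp_feedback hx hν
  have hy : MemLp (fun ω => D.A *ᵥ x ω + D.B *ᵥ feedback D T t (x ω) (ν ω)) 2 P :=
    (memLp_mulVec D.A hx).add (memLp_mulVec D.B hu)
  have hdev : MemLp (fun ω => μ - ν ω) 2 P := (memLp_const μ).sub hν
  have hleft := (((hasExpectation_integral (integrable_quadratic (D.Q t) hx)).add
    (hasExpectation_integral (integrable_quadratic (D.R t) hu))).add
    (hasExpectation_integral (integrable_quadratic (riccati D T (t + 1)) hy))).add
    ((hasExpectation_dotProduct_const hy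
      ((riccati D T (t + 1) + adjointL D T (t + 1)) *ᵥ μ)).const_mul 2)
  have hright := ((hasExpectation_integral
    (integrable_costToGo (D := D) (T := T) (t := t) hx μ)).add
    (hasExpectation_integral (integrable_quadratic (dMat D T t) hdev))).sub
    (HasExpectation.const (μ ⬝ᵥ dMat D T t *ᵥ μ))
  rw [← hleft.integral_eq, ← hright.integral_eq]
  exact integral_congr_ae (ae_of_all _ fun ω => hD.bellman_feedback ht (x ω) μ (ν ω))

/-- Both the true successor `A x + B u` and the one `A (x + e) + B u` predicted from the estimate
are perturbations of `y = A x + B u₀`, where the input `u₀` is computed from the exact state, by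
linear images of `e`; this is why only second moments of `e` survive. -/
theorem integral_state_add_successor (ht : t ≤ T) (hx : MemLp x 2 P) (hν : MemLp ν 2 P)
    (he : MemLp e 2 P) (hind : IndepFun (fun ω => (x ω, ν ω)) e P) (he_zero : ∫ ω, e ω ∂P = 0) :
    (∫ ω, x ω ⬝ᵥ D.Q t *ᵥ x ω ∂P)
        + ∫ ω, (D.A *ᵥ x ω + D.B *ᵥ feedback D T t (x ω + e ω) (ν ω)) ⬝ᵥ riccati D T (t + 1) *ᵥ
            (D.A *ᵥ x ω + D.B *ᵥ feedback D T t (x ω + e ω) (ν ω)) ∂P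
      = (∫ ω, (x ω + e ω) ⬝ᵥ D.Q t *ᵥ (x ω + e ω) ∂P)
        + (∫ ω, (D.A *ᵥ (x ω + e ω) + D.B *ᵥ feedback D T t (x ω + e ω) (ν ω)) ⬝ᵥ
            riccati D T (t + 1) *ᵥ
            (D.A *ᵥ (x ω + e ω) + D.B *ᵥ feedback D T t (x ω + e ω) (ν ω)) ∂P)
        + (D.Aᵀ * riccati D T (t + 1) * D.B * (upsilon D T t)⁻¹ * D.Bᵀ * riccati D T (t + 1) * D.A
            * momentMatrix P e).trace
        - (riccati D T t * momentMatrix P e).trace := by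
  set K := riccatiGain D.A D.B (D.R t) (riccati D T (t + 1))
  set F := closedLoop D.A D.B (D.R t) (riccati D T (t + 1))
  let y ω := D.A *ᵥ x ω + D.B *ᵥ feedback D T t (x ω) (ν ω)
  have hy : MemLp y 2 P := by
    have hu : MemLp (fun ω => feedback D T t (x ω) (ν ω)) 2 P := memLp_feedback hx hν
    exact (memLp_mulVec D.A hx).add (memLp_mulVec D.B hu)
  have hye : IndepFun y e P := by
    have hmeas : Measurable fun z : (Fin n → ℝ) × (Fin n → ℝ) =>
        D.A *ᵥ z.1 + D.B *ᵥ feedback D T t z.1 z.2 :=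
      Continuous.measurable (by unfold feedback; fun_prop)
    exact hind.comp hmeas measurable_id
  have hperturb (N : Matrix (Fin n) (Fin n) ℝ) := (hasExpectation_quadratic_add_mulVec
    (hD.riccati_isSymm T (t + 1)) N hy he hye he_zero
    (hasExpectation_integral (integrable_quadratic _ hy))).integral_eq
  have hstate := (hasExpectation_quadratic_add_of_integral_eq_zero
    (isSymm_of_posSemidef (hD.state_posSemidef t)) hx he (hind.comp measurable_fst measurable_id)
    he_zero (hasExpectation_integral (integrable_quadratic _ hx))).integral_eq
  have htrue ω : D.A *ᵥ x ω + D.B *ᵥ feedback D T t (x ω + e ω) (ν ω)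
      = y ω + (-(D.B * K)) *ᵥ e ω := by
    simp only [y, feedback_add, mulVec_sub, neg_mulVec, mulVec_mulVec, K]
    abel
  have hpredicted ω : D.A *ᵥ (x ω + e ω) + D.B *ᵥ feedback D T t (x ω + e ω) (ν ω)
      = y ω + F *ᵥ e ω := by
    simp only [y, F, closedLoop, feedback_add, mulVec_add, mulVec_sub, sub_mulVec, mulVec_mulVec]
    abel
  simp only [htrue, hpredicted, hstate, hperturb, transpose_neg, Matrix.neg_mul, Matrix.mul_neg,
    neg_neg]
  linear_combination hD.trace_gain_sub_closedLoop ht (momentMatrix P e)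

end WeightsDefinite

end OneStep

section CertaintyEquivalence

variable {n m M : ℕ} {Ω : Type*}

section Loop

variable (D : Model n m M) (T : ℕ) (x₀ : Ω → Fin n → ℝ) (w v ν : ℕ → Ω → Fin n → ℝ)

/-- The state of the certainty-equivalent closed loop, in which the feedback law uses an arbitrary
random vector `ν t` in place of the mean of the system noise. -/
def ceState : ℕ → Ω → Fin n → ℝ
  | 0 => x₀
  | t + 1 => fun ω => D.A *ᵥ ceState t ω
      + D.B *ᵥ feedback D T t (ceState t ω + D.C⁻¹ *ᵥ v t ω) (ν t ω) + w t ω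

/-- The state estimate `x̂(t) = x(t) + C⁻¹ v(t)` belonging to `ceState`. -/
def ceStateEst (t : ℕ) (ω : Ω) : Fin n → ℝ :=
  ceState D T x₀ w v ν t ω + D.C⁻¹ *ᵥ v t ω

/-- The input belonging to `ceState`. -/
def ceInput (t : ℕ) (ω : Ω) : Fin m → ℝ :=
  feedback D T t (ceStateEst D T x₀ w v ν t ω) (ν t ω)

/-- The successor `A x(t) + B u(t)` of `ceState` before the system noise is added. -/
def ceDrift (t : ℕ) (ω : Ω) : Fin n → ℝ :=
  D.A *ᵥ ceState D T x₀ w v ν t ω + D.B *ᵥ ceInput D T x₀ w v ν t ω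

/-- The cost of stage `t` belonging to `ceState`. -/
def ceStageCost (t : ℕ) (ω : Ω) : ℝ :=
  ceState D T x₀ w v ν t ω ⬝ᵥ D.Q t *ᵥ ceState D T x₀ w v ν t ω
    + ceInput D T x₀ w v ν t ω ⬝ᵥ D.R t *ᵥ ceInput D T x₀ w v ν t ω

/-- The terminal cost belonging to `ceState`. -/
def ceTerminalCost (ω : Ω) : ℝ :=
  ceState D T x₀ w v ν (T + 1) ω ⬝ᵥ D.Pterm T *ᵥ ceState D T x₀ w v ν (T + 1) ω

theorem ceState_succ (t : ℕ) :
    ceState D T x₀ w v ν (t + 1) = fun ω => ceDrift D T x₀ w v ν t ω + w t ω :=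
  rfl

end Loop

/-- Estimates of the mean of the system noise whose value at time `t` only depends on the noises
before time `t`. -/
structure CausalEstimate [MeasurableSpace Ω] (P : Measure Ω) (x₀ : Ω → Fin n → ℝ)
    (w v ν : ℕ → Ω → Fin n → ℝ) : Prop where
  measurable : ∀ t, Measurable[past x₀ w v t t] (ν t)
  memLp : ∀ t, MemLp (ν t) 2 P

theorem NoiseModel.memLp_ceStateEst [MeasurableSpace Ω] {P : Measure Ω} [IsFiniteMeasure P]
    {D : Model n m M} {p : Fin M → ℝ} {x₀ : Ω → Fin n → ℝ} {w v ν : ℕ → Ω → Fin n → ℝ} {v_b : ℝ}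
    (h : NoiseModel P D p x₀ w v v_b) {T t : ℕ} (hx : MemLp (ceState D T x₀ w v ν t) 2 P) :
    MemLp (ceStateEst D T x₀ w v ν t) 2 P :=
  hx.add (memLp_mulVec D.C⁻¹ (h.memLp_v t))

namespace CausalEstimate

variable [MeasurableSpace Ω] {P : Measure Ω} {x₀ : Ω → Fin n → ℝ} {w v ν : ℕ → Ω → Fin n → ℝ}
  (hν : CausalEstimate P x₀ w v ν) (D : Model n m M) (T t : ℕ)
include hν

theorem measurable_ceDrift (hx : Measurable[past x₀ w v t t] (ceState D T x₀ w v ν t)) :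
    Measurable[past x₀ w v t (t + 1)] (ceDrift D T x₀ w v ν t) := by
  have hle : past x₀ w v t t ≤ past x₀ w v t (t + 1) := past_mono x₀ w v le_rfl (Nat.le_succ t)
  have htriple := (hx.mono hle le_rfl).prodMk
    ((measurable_past_v x₀ w v t (Nat.lt_succ_self t)).prodMk ((hν.measurable t).mono hle le_rfl))
  have hmap : Measurable fun z : (Fin n → ℝ) × (Fin n → ℝ) × (Fin n → ℝ) =>
      D.A *ᵥ z.1 + D.B *ᵥ feedback D T t (z.1 + D.C⁻¹ *ᵥ z.2.1) z.2.2 :=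
    Continuous.measurable (by unfold feedback; fun_prop)
  exact hmap.comp htriple

theorem measurable_ceState : Measurable[past x₀ w v t t] (ceState D T x₀ w v ν t) := by
  induction t with
  | zero => exact measurable_past_init x₀ w v 0 0
  | succ t ih =>
    have hdrift := (hν.measurable_ceDrift D T t ih).mono
      (past_mono x₀ w v (Nat.le_succ t) le_rfl) le_rfl
    exact hdrift.add (measurable_past_w x₀ w v (Nat.lt_succ_self t) (t + 1))

section SecondMoments

variable [IsFiniteMeasure P] {D : Model n m M} {p : Fin M → ℝ} {v_b : ℝ}
  (h : NoiseModel P D p x₀ w v v_b) {T t}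
include h

theorem memLp_ceInput (hx : MemLp (ceState D T x₀ w v ν t) 2 P) :
    MemLp (ceInput D T x₀ w v ν t) 2 P :=
  memLp_feedback (h.memLp_ceStateEst hx) (hν.memLp t)

theorem memLp_ceDrift (hx : MemLp (ceState D T x₀ w v ν t) 2 P) :
    MemLp (ceDrift D T x₀ w v ν t) 2 P :=
  (memLp_mulVec D.A hx).add (memLp_mulVec D.B (hν.memLp_ceInput h hx))

theorem memLp_ceState (T t : ℕ) : MemLp (ceState D T x₀ w v ν t) 2 P := by
  induction t with
  | zero => exact h.memLp_init
  | succ t ih => exact (hν.memLp_ceDrift h ih).add (h.memLp_w t)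

theorem integral_ceDrift (T t : ℕ) :
    ∫ ω, D.A *ᵥ ceStateEst D T x₀ w v ν t ω + D.B *ᵥ ceInput D T x₀ w v ν t ω ∂P
      = ∫ ω, ceDrift D T x₀ w v ν t ω ∂P := by
  have hx := hν.memLp_ceState h T t
  have herror : MemLp (fun ω => D.C⁻¹ *ᵥ v t ω) 2 P := memLp_mulVec D.C⁻¹ (h.memLp_v t)
  have hsplit : (fun ω => D.A *ᵥ ceStateEst D T x₀ w v ν t ω + D.B *ᵥ ceInput D T x₀ w v ν t ω)
      = fun ω => ceDrift D T x₀ w v ν t ω + D.A *ᵥ (D.C⁻¹ *ᵥ v t ω) := by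
    funext ω
    simp only [ceDrift, ceStateEst, mulVec_add]
    abel
  rw [hsplit, integral_add ((hν.memLp_ceDrift h hx).integrable one_le_two)
    ((memLp_mulVec D.A herror).integrable one_le_two), integral_mulVec D.A herror,
    h.integral_mulVec_v, mulVec_zero, add_zero]

end SecondMoments

section Cost

variable [IsProbabilityMeasure P] {D : Model n m M} {p : Fin M → ℝ} {v_b : ℝ}
  (h : NoiseModel P D p x₀ w v v_b) {T t : ℕ}
include h

/-- The traces involving `P_T(t)` and `P_T(t+1)` are arranged so that the identity telescopes in
`t`. -/
theorem integral_ceStageCost_add_costToGo (hD : WeightsDefinite D) (ht : t ≤ T) :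
    ∫ ω, ceStageCost D T x₀ w v ν t ω ∂P
        + ((∫ ω, costToGo D T (t + 1) (meanOf D.atom p) (ceStateEst D T x₀ w v ν (t + 1) ω) ∂P)
          - (riccati D T (t + 1) * (D.C⁻¹ * momentMatrix P (v 0) * D.C⁻¹ᵀ)).trace)
      = ((∫ ω, costToGo D T t (meanOf D.atom p) (ceStateEst D T x₀ w v ν t ω) ∂P)
          - (riccati D T t * (D.C⁻¹ * momentMatrix P (v 0) * D.C⁻¹ᵀ)).trace)
        + (-(meanOf D.atom p ⬝ᵥ dMat D T t *ᵥ meanOf D.atom p)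
          + 2 * (meanOf D.atom p ⬝ᵥ adjointL D T (t + 1) *ᵥ meanOf D.atom p)
          + (D.Aᵀ * riccati D T (t + 1) * D.B * (upsilon D T t)⁻¹ * D.Bᵀ * riccati D T (t + 1)
              * D.A * (D.C⁻¹ * momentMatrix P (v 0) * D.C⁻¹ᵀ)).trace
          + (riccati D T (t + 1) * secondMoment D.atom p).trace)
        + ∫ ω, (meanOf D.atom p - ν t ω) ⬝ᵥ dMat D T t *ᵥ (meanOf D.atom p - ν t ω) ∂P := by
  have hx := hν.memLp_ceState h T t
  have hξ := h.memLp_ceStateEst hx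
  have hu := hν.memLp_ceInput h hx
  have hdrift := hν.memLp_ceDrift h hx
  have hxm := hν.measurable_ceState D T t
  have hdrift_w : IndepFun (ceDrift D T x₀ w v ν t) (w t) P :=
    h.indepFun_w (hν.measurable_ceDrift D T t hxm)
  have herror (s : ℕ) : MemLp (fun ω => D.C⁻¹ *ᵥ v s ω) 2 P := memLp_mulVec D.C⁻¹ (h.memLp_v s)
  have hind_t : IndepFun (fun ω => (ceState D T x₀ w v ν t ω, ν t ω)) (fun ω => D.C⁻¹ *ᵥ v t ω) P :=
    (h.indepFun_v (hxm.prodMk (hν.measurable t))).comp measurable_id (measurable_mulVec D.C⁻¹)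
  have hind_succ : IndepFun (ceState D T x₀ w v ν (t + 1)) (fun ω => D.C⁻¹ *ᵥ v (t + 1) ω) P :=
    (h.indepFun_v (hν.measurable_ceState D T (t + 1))).comp measurable_id (measurable_mulVec D.C⁻¹)
  have hstage : ∫ ω, ceStageCost D T x₀ w v ν t ω ∂P = _ :=
    integral_add (integrable_quadratic (D.Q t) hx) (integrable_quadratic (D.R t) hu)
  have hestimated := hD.integral_state_add_successor ht hx (hν.memLp t) (herror t) hind_t
    (h.integral_mulVec_v D.C⁻¹ t)
  have hbellman := hD.integral_bellman_feedback ht hξ (hν.memLp t) (meanOf D.atom p)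
  have hnext := hD.integral_costToGo_add_noises (T := T) (t := t + 1) hdrift (h.memLp_w t)
    (herror (t + 1)) hdrift_w hind_succ (h.integral_mulVec_v D.C⁻¹ (t + 1))
  have hmean := hν.integral_ceDrift h T t
  rw [h.momentMatrix_mulVec_v] at hestimated hnext
  rw [h.integral_w, h.momentMatrix_w] at hnext
  rw [show (∫ ω, D.A *ᵥ ceStateEst D T x₀ w v ν t ω + D.B *ᵥ feedback D T t
    (ceStateEst D T x₀ w v ν t ω) (ν t ω) ∂P) = _ from hmean] at hbellman
  simp only [ceStageCost, ceDrift, ceStateEst, ceInput, ceState_succ]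
    at hstage hestimated hbellman hnext ⊢
  linear_combination hstage + hestimated + hbellman + hnext

theorem integral_costToGo_terminal (hD : WeightsDefinite D) (T : ℕ) (μ : Fin n → ℝ) :
    ∫ ω, costToGo D T (T + 1) μ (ceStateEst D T x₀ w v ν (T + 1) ω) ∂P
      = (∫ ω, ceTerminalCost D T x₀ w v ν ω ∂P)
        + (riccati D T (T + 1) * (D.C⁻¹ * momentMatrix P (v 0) * D.C⁻¹ᵀ)).trace := by
  have hx := hν.memLp_ceState h T (T + 1)
  have hind : IndepFun (ceState D T x₀ w v ν (T + 1)) (fun ω => D.C⁻¹ *ᵥ v (T + 1) ω) P :=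
    (h.indepFun_v (hν.measurable_ceState D T (T + 1))).comp measurable_id (measurable_mulVec D.C⁻¹)
  have hquad := hasExpectation_quadratic_add_of_integral_eq_zero (hD.riccati_isSymm T (T + 1)) hx
    (memLp_mulVec D.C⁻¹ (h.memLp_v (T + 1))) hind (h.integral_mulVec_v D.C⁻¹ (T + 1))
    (hasExpectation_integral (integrable_quadratic _ hx))
  rw [h.momentMatrix_mulVec_v] at hquad
  simpa only [costToGo, adjointL_terminal, zero_mulVec, dotProduct_zero, mul_zero, add_zero,
    riccati_terminal, ceTerminalCost, ceStateEst] using hquad.integral_eq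

theorem sum_integral_ceStageCost_add_integral_ceTerminalCost (hD : WeightsDefinite D) (T : ℕ) :
    ∑ t ∈ Finset.range (T + 1), ∫ ω, ceStageCost D T x₀ w v ν t ω ∂P
        + ∫ ω, ceTerminalCost D T x₀ w v ν ω ∂P
      = (∫ ω, costToGo D T 0 (meanOf D.atom p) (ceStateEst D T x₀ w v ν 0 ω) ∂P)
        + hConst D p (D.C⁻¹ * momentMatrix P (v 0) * D.C⁻¹ᵀ) T
        + ∑ t ∈ Finset.range (T + 1),
          ∫ ω, (meanOf D.atom p - ν t ω) ⬝ᵥ dMat D T t *ᵥ (meanOf D.atom p - ν t ω) ∂P := by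
  have hsum := Finset.sum_congr rfl fun t (ht : t ∈ Finset.range (T + 1)) =>
    hν.integral_ceStageCost_add_costToGo h hD (Nat.lt_succ_iff.1 (Finset.mem_range.1 ht))
  have htelescope := Finset.sum_range_sub (fun t =>
    (∫ ω, costToGo D T t (meanOf D.atom p) (ceStateEst D T x₀ w v ν t ω) ∂P)
      - (riccati D T t * (D.C⁻¹ * momentMatrix P (v 0) * D.C⁻¹ᵀ)).trace) (T + 1)
  have hterminal := hν.integral_costToGo_terminal h hD T (meanOf D.atom p)
  rw [Finset.sum_sub_distrib] at htelescope
  rw [Finset.sum_add_distrib, Finset.sum_add_distrib, Finset.sum_add_distrib] at hsum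
  rw [hConst]
  linear_combination hsum - htelescope - hterminal

end Cost

end CausalEstimate

end CertaintyEquivalence

theorem forall_dist_le_iff_eq {ι X : Type*} [PseudoMetricSpace X] {a : ι → X} {r : ℝ} {z : X}
    {k : ι} (ha : Pairwise fun i j => 2 * r < dist (a i) (a j)) (hz : dist z (a k) ≤ r) (i : ι) :
    (∀ j, dist z (a i) ≤ dist z (a j)) ↔ i = k := by
  refine ⟨fun h => ?_, ?_⟩
  · by_contra hik
    linarith [ha hik, h k, dist_triangle_left (a i) (a k) z]
  · rintro rfl j
    rcases eq_or_ne i j with rfl | hij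
    · rfl
    · linarith [ha hij, dist_triangle_left (a i) (a j) z]

section Identification

variable {n m M : ℕ} {Ω : Type*}

theorem vecNorm_sub_eq_dist (y z : Fin n → ℝ) :
    vecNorm (y - z) = dist (WithLp.toLp 2 y) (WithLp.toLp 2 z) := by
  rw [vecNorm, WithLp.toLp_sub, dist_eq_norm]

theorem vecNorm_mulVec_le (N : Matrix (Fin n) (Fin n) ℝ) {z : Fin n → ℝ} {r : ℝ}
    (hz : vecNorm z ≤ r) : vecNorm (N *ᵥ z) ≤ opNorm N * r := by
  have h := (Matrix.toEuclideanCLM (n := Fin n) (𝕜 := ℝ) N).le_opNorm_of_le hz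
  rwa [toEuclideanCLM_toLp] at h

/-- The separation condition (H3) on the values of the system noise. -/
def Separated (D : Model n m M) (v_b : ℝ) : Prop :=
  ∀ i j, i ≠ j → 2 * (1 + opNorm D.A) * opNorm D.C⁻¹ * v_b < vecNorm (D.atom i - D.atom j)

/-- Paths of the noises that avoid the null sets on which the measurement noise exceeds its bound or
the system noise is not one of its possible values. -/
structure RegularPath (D : Model n m M) (w v : ℕ → Ω → Fin n → ℝ) (v_b : ℝ) (ω : Ω) : Prop where
  vecNorm_v_le : ∀ t, vecNorm (v t ω) ≤ v_b
  w_mem_range_atom : ∀ t, w t ω ∈ Set.range D.atom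

theorem NoiseModel.ae_regularPath [MeasurableSpace Ω] {P : Measure Ω} {D : Model n m M}
    {p : Fin M → ℝ} {x₀ : Ω → Fin n → ℝ} {w v : ℕ → Ω → Fin n → ℝ} {v_b : ℝ}
    (h : NoiseModel P D p x₀ w v v_b) : ∀ᵐ ω ∂P, RegularPath D w v v_b ω := by
  filter_upwards [ae_all_iff.2 h.ae_vecNorm_v_le, ae_all_iff.2 h.ae_w_mem_range_atom]
    with ω hv hw using ⟨hv, hw⟩

variable {D : Model n m M} {π : Policy n m} {x₀ : Ω → Fin n → ℝ} {w v ν : ℕ → Ω → Fin n → ℝ}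
  {v_b : ℝ} {t : ℕ} {ω : Ω}

theorem stateEst_eq (hC : IsUnit D.C.det) :
    stateEst D π x₀ w v t ω = state D π x₀ w v t ω + D.C⁻¹ *ᵥ v t ω := by
  rw [stateEst, output, mulVec_add, mulVec_mulVec, nonsing_inv_mul _ hC, one_mulVec]

theorem noiseEst_eq (hC : IsUnit D.C.det) :
    noiseEst D π x₀ w v t ω
      = w t ω + (D.C⁻¹ *ᵥ v (t + 1) ω - D.A *ᵥ (D.C⁻¹ *ᵥ v t ω)) := by
  rw [noiseEst, stateEst_eq hC, stateEst_eq hC, state_succ, mulVec_add]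
  abel

namespace RegularPath

variable (h : RegularPath D w v v_b ω)
include h

theorem vecNorm_noiseEst_sub_w_le (hC : IsUnit D.C.det) :
    vecNorm (noiseEst D π x₀ w v t ω - w t ω) ≤ (1 + opNorm D.A) * opNorm D.C⁻¹ * v_b := by
  have herror (s : ℕ) : vecNorm (D.C⁻¹ *ᵥ v s ω) ≤ opNorm D.C⁻¹ * v_b :=
    vecNorm_mulVec_le _ (h.vecNorm_v_le s)
  rw [noiseEst_eq hC, add_sub_cancel_left]
  calc vecNorm (D.C⁻¹ *ᵥ v (t + 1) ω - D.A *ᵥ (D.C⁻¹ *ᵥ v t ω))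
    _ ≤ vecNorm (D.C⁻¹ *ᵥ v (t + 1) ω) + vecNorm (D.A *ᵥ (D.C⁻¹ *ᵥ v t ω)) :=
      norm_sub_le (WithLp.toLp 2 _) (WithLp.toLp 2 _)
    _ ≤ opNorm D.C⁻¹ * v_b + opNorm D.A * (opNorm D.C⁻¹ * v_b) :=
      add_le_add (herror _) (vecNorm_mulVec_le _ (herror t))
    _ = (1 + opNorm D.A) * opNorm D.C⁻¹ * v_b := by ring

variable (hC : IsUnit D.C.det) (hsep : Separated D v_b)
include hC hsep

theorem isMinimizer_iff_eq {k : Fin M} (hk : D.atom k = w t ω) (i : Fin M) :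
    (∀ j, vecNorm (noiseEst D π x₀ w v t ω - D.atom i)
        ≤ vecNorm (noiseEst D π x₀ w v t ω - D.atom j)) ↔ i = k := by
  have hz := h.vecNorm_noiseEst_sub_w_le (π := π) (x₀ := x₀) (t := t) hC
  simp only [Separated, ← hk, vecNorm_sub_eq_dist] at hz hsep ⊢
  exact forall_dist_le_iff_eq (a := fun i => WithLp.toLp 2 (D.atom i))
    (fun i j hij => by linarith [hsep i j hij]) hz i

theorem isMinimizer_iff (i : Fin M) :
    (∀ j, vecNorm (noiseEst D π x₀ w v t ω - D.atom i)
        ≤ vecNorm (noiseEst D π x₀ w v t ω - D.atom j)) ↔ w t ω = D.atom i := by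
  obtain ⟨k, hk⟩ := h.w_mem_range_atom t
  refine ⟨fun hi => ?_, fun hi => (h.isMinimizer_iff_eq hC hsep hi.symm i).2 rfl⟩
  rw [(h.isMinimizer_iff_eq hC hsep hk i).1 hi, hk]

theorem nearestIndex_noiseEst_eq_iff [NeZero M] (i : Fin M) :
    nearestIndex D.atom (noiseEst D π x₀ w v t ω) = i ↔ w t ω = D.atom i := by
  have hmin := nearestIndex_spec D.atom (noiseEst D π x₀ w v t ω)
  refine ⟨?_, fun hi => (h.isMinimizer_iff_eq hC hsep hi.symm _).1 hmin⟩
  rintro rfl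
  exact (h.isMinimizer_iff hC hsep _).1 hmin

end RegularPath

theorem probEst_apply {t : ℕ} (h : Fin t → Fin M) (i : Fin M) :
    probEst h i = ({s : Fin t | h s = i}.ncard : ℝ) / t := by
  classical
  rw [Set.ncard_eq_toFinset_card', probEst, Pi.smul_apply, Finset.sum_apply, smul_eq_mul,
    one_div, div_eq_inv_mul]
  congr 1
  simp [Pi.single_apply, eq_comm, Finset.sum_boole]

theorem meanOf_probEst (a : Fin M → Fin n → ℝ) {t : ℕ} (h : Fin t → Fin M) :
    meanOf a (probEst h) = (1 / (t : ℝ)) • ∑ s, a (h s) := by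
  classical
  simp only [meanOf, probEst, Pi.smul_apply, Finset.sum_apply, smul_assoc, ← Finset.smul_sum,
    Finset.sum_smul]
  rw [Finset.sum_comm]
  simp [Pi.single_apply, ite_smul]

theorem historyProbEst_eq_probEst [NeZero M] (t : ℕ) (ω : Ω) :
    historyProbEst D t (fun s => output D π x₀ w v s ω) (fun s => input D π x₀ w v s ω)
      = probEst fun s : Fin t => nearestIndex D.atom (noiseEst D π x₀ w v s ω) :=
  rfl

/-- The sample mean of `w(0), …, w(t-1)`, which is `0` for `t = 0`. -/
def sampleMean (w : ℕ → Ω → Fin n → ℝ) (t : ℕ) (ω : Ω) : Fin n → ℝ :=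
  (1 / (t : ℝ)) • ∑ s : Fin t, w s ω

namespace RegularPath

variable [NeZero M] (h : RegularPath D w v v_b ω) (hC : IsUnit D.C.det) (hsep : Separated D v_b)
include h hC hsep

theorem historyProbEst_eq_frequency (t : ℕ) (i : Fin M) :
    historyProbEst D t (fun s => output D π x₀ w v s ω) (fun s => input D π x₀ w v s ω) i
      = ({s : Fin t | w s ω = D.atom i}.ncard : ℝ) / t := by
  simp only [historyProbEst_eq_probEst, probEst_apply, h.nearestIndex_noiseEst_eq_iff hC hsep]

theorem meanOf_historyProbEst (t : ℕ) :
    meanOf D.atom (historyProbEst D t (fun s => output D π x₀ w v s ω)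
      (fun s => input D π x₀ w v s ω)) = sampleMean w t ω := by
  rw [historyProbEst_eq_probEst, meanOf_probEst, sampleMean]
  congr 1
  exact Finset.sum_congr rfl fun s _ =>
    ((h.nearestIndex_noiseEst_eq_iff hC hsep _).1 rfl).symm

theorem input_learningPolicy (T t : ℕ) :
    input D (learningPolicy D T) x₀ w v t ω
      = feedback D T t (stateEst D (learningPolicy D T) x₀ w v t ω) (sampleMean w t ω) := by
  rw [input_eq, ← h.meanOf_historyProbEst (π := learningPolicy D T) (x₀ := x₀) hC hsep t]
  rfl

end RegularPath

theorem mean_sub_sampleMean_eq (w : ℕ → Ω → Fin n → ℝ) (μ : Fin n → ℝ) {t : ℕ} (ht : t ≠ 0)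
    (ω : Ω) : μ - sampleMean w t ω = (-(1 / (t : ℝ))) • ∑ s : Fin t, (w s ω - μ) := by
  have ht' : (t : ℝ) ≠ 0 := Nat.cast_ne_zero.2 ht
  rw [Finset.sum_sub_distrib, sampleMean, Finset.sum_const, Finset.card_univ, Fintype.card_fin,
    smul_sub, neg_smul, neg_smul, ← Nat.cast_smul_eq_nsmul ℝ t, smul_smul, one_div_mul_cancel ht',
    one_smul]
  abel

theorem measurable_sampleMean (x₀ : Ω → Fin n → ℝ) (w v : ℕ → Ω → Fin n → ℝ) (t : ℕ) :
    Measurable[past x₀ w v t t] (sampleMean w t) := by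
  have hsum := Finset.measurable_fun_sum Finset.univ fun (s : Fin t) _ =>
    measurable_past_w x₀ w v s.2 t
  exact hsum.const_smul (1 / (t : ℝ))

theorem input_offlinePolicy (p : Fin M → ℝ) (T t : ℕ) (ω : Ω) :
    input D (offlinePolicy D p T) x₀ w v t ω
      = feedback D T t (stateEst D (offlinePolicy D p T) x₀ w v t ω) (meanOf D.atom p) := by
  rw [input_eq]
  rfl

theorem state_eq_ceState_and_input_eq_ceInput (hC : IsUnit D.C.det) {T : ℕ}
    (h : ∀ t, input D π x₀ w v t ω = feedback D T t (stateEst D π x₀ w v t ω) (ν t ω)) (t : ℕ) :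
    state D π x₀ w v t ω = ceState D T x₀ w v ν t ω ∧
      input D π x₀ w v t ω = ceInput D T x₀ w v ν t ω := by
  have hinput (t : ℕ) (ht : state D π x₀ w v t ω = ceState D T x₀ w v ν t ω) :
      input D π x₀ w v t ω = ceInput D T x₀ w v ν t ω := by
    rw [h, stateEst_eq hC, ht, ceInput, ceStateEst]
  suffices hstate : state D π x₀ w v t ω = ceState D T x₀ w v ν t ω from ⟨hstate, hinput t hstate⟩
  induction t with
  | zero => rfl
  | succ t ih =>
    rw [state_succ, ih, hinput t ih]
    rfl

end Identification

theorem trace_mul_vecMulVec {n : ℕ} (N : Matrix (Fin n) (Fin n) ℝ) (z : Fin n → ℝ) :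
    (N * vecMulVec z z).trace = z ⬝ᵥ N *ᵥ z := by
  rw [mul_vecMulVec, trace_vecMulVec, dotProduct_comm]

section CostFormulas

variable {n m M : ℕ} {Ω : Type*} [MeasurableSpace Ω] {P : Measure Ω} {D : Model n m M}
  {p : Fin M → ℝ} {x₀ : Ω → Fin n → ℝ} {w v ν : ℕ → Ω → Fin n → ℝ} {v_b : ℝ}

/-- The policy `π` is the certainty-equivalent feedback that uses `ν t` in place of the mean of the
system noise. -/
def IsCertaintyEquivalent (P : Measure Ω) (D : Model n m M) (T : ℕ) (π : Policy n m)
    (x₀ : Ω → Fin n → ℝ) (w v ν : ℕ → Ω → Fin n → ℝ) : Prop :=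
  ∀ᵐ ω ∂P, ∀ t, input D π x₀ w v t ω = feedback D T t (stateEst D π x₀ w v t ω) (ν t ω)

namespace IsCertaintyEquivalent

variable {T : ℕ} {π : Policy n m} (hπ : IsCertaintyEquivalent P D T π x₀ w v ν)
  (hC : IsUnit D.C.det)
include hπ hC

theorem stageCost_ae_eq (t : ℕ) :
    stageCost D π x₀ w v t =ᵐ[P] ceStageCost D T x₀ w v ν t := by
  filter_upwards [hπ] with ω hω
  obtain ⟨hstate, hinput⟩ := state_eq_ceState_and_input_eq_ceInput hC hω t
  rw [stageCost, hstate, hinput, ceStageCost]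

theorem terminalCost_ae_eq : terminalCost D π x₀ w v T =ᵐ[P] ceTerminalCost D T x₀ w v ν := by
  filter_upwards [hπ] with ω hω
  rw [terminalCost, (state_eq_ceState_and_input_eq_ceInput hC hω (T + 1)).1, ceTerminalCost]

variable (hν : CausalEstimate P x₀ w v ν) (h : NoiseModel P D p x₀ w v v_b)
include hν h

theorem costIntegrable [IsFiniteMeasure P] : CostIntegrable P D π x₀ w v T := by
  have hx (t : ℕ) := hν.memLp_ceState h T t
  refine ⟨fun t _ => ?_, ?_⟩
  · refine Integrable.congr ?_ (hπ.stageCost_ae_eq hC t).symm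
    exact (integrable_quadratic _ (hx t)).add (integrable_quadratic _ (hν.memLp_ceInput h (hx t)))
  · exact (integrable_quadratic _ (hx (T + 1))).congr (hπ.terminalCost_ae_eq hC).symm

theorem cost_eq [IsProbabilityMeasure P] (hD : WeightsDefinite D) :
    cost P D π x₀ w v T
      = (∫ ω, costToGo D T 0 (meanOf D.atom p) (D.C⁻¹ *ᵥ (D.C *ᵥ x₀ ω + v 0 ω)) ∂P)
        + hConst D p (D.C⁻¹ * momentMatrix P (v 0) * D.C⁻¹ᵀ) T
        + ∑ t ∈ Finset.range (T + 1),
          ∫ ω, (meanOf D.atom p - ν t ω) ⬝ᵥ dMat D T t *ᵥ (meanOf D.atom p - ν t ω) ∂P := by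
  have hest (ω : Ω) : D.C⁻¹ *ᵥ (D.C *ᵥ x₀ ω + v 0 ω) = ceStateEst D T x₀ w v ν 0 ω :=
    stateEst_eq (π := π) (x₀ := x₀) (w := w) (t := 0) hC
  simp only [hest, cost, integral_congr_ae (hπ.terminalCost_ae_eq hC),
    integral_congr_ae (hπ.stageCost_ae_eq hC _)]
  exact hν.sum_integral_ceStageCost_add_integral_ceTerminalCost h hD T

end IsCertaintyEquivalent

theorem isCertaintyEquivalent_offlinePolicy (P : Measure Ω) (D : Model n m M) (p : Fin M → ℝ)
    (T : ℕ) (x₀ : Ω → Fin n → ℝ) (w v : ℕ → Ω → Fin n → ℝ) :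
    IsCertaintyEquivalent P D T (offlinePolicy D p T) x₀ w v fun _ _ => meanOf D.atom p :=
  ae_of_all _ fun ω t => input_offlinePolicy p T t ω

theorem causalEstimate_const [IsFiniteMeasure P] (x₀ : Ω → Fin n → ℝ) (w v : ℕ → Ω → Fin n → ℝ)
    (μ : Fin n → ℝ) : CausalEstimate P x₀ w v fun _ _ => μ :=
  ⟨fun _ => measurable_const, fun _ => memLp_const μ⟩

namespace NoiseModel

variable (h : NoiseModel P D p x₀ w v v_b)
include h

theorem ae_exact_identification [NeZero M] (hC : IsUnit D.C.det) (hsep : Separated D v_b)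
    (π : Policy n m) :
    ∀ᵐ ω ∂P, ∀ t,
      (∀ i, (∀ j, vecNorm (noiseEst D π x₀ w v t ω - D.atom i)
          ≤ vecNorm (noiseEst D π x₀ w v t ω - D.atom j)) ↔ w t ω = D.atom i) ∧
      ∀ i, historyProbEst D t (fun s => output D π x₀ w v s ω) (fun s => input D π x₀ w v s ω) i
        = ({s : Fin t | w s ω = D.atom i}.ncard : ℝ) / t := by
  filter_upwards [h.ae_regularPath] with ω hω t using
    ⟨hω.isMinimizer_iff hC hsep, hω.historyProbEst_eq_frequency hC hsep t⟩

theorem isCertaintyEquivalent_learningPolicy [NeZero M] (hC : IsUnit D.C.det)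
    (hsep : Separated D v_b) (T : ℕ) :
    IsCertaintyEquivalent P D T (learningPolicy D T) x₀ w v (sampleMean w) := by
  filter_upwards [h.ae_regularPath] with ω hω t using hω.input_learningPolicy hC hsep T t

variable [IsProbabilityMeasure P]

theorem causalEstimate_sampleMean : CausalEstimate P x₀ w v (sampleMean w) where
  measurable := measurable_sampleMean x₀ w v
  memLp t := by
    have hsum := memLp_finsetSum Finset.univ fun (s : Fin t) _ => h.memLp_w s
    exact hsum.const_smul (1 / (t : ℝ))

theorem momentMatrix_w_sub_mean (t : ℕ) :
    momentMatrix P (fun ω => w t ω - meanOf D.atom p) = covariance D.atom p := by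
  have hcov := momentMatrix_sub_integral (h.memLp_w t)
  rwa [h.integral_w, h.momentMatrix_w] at hcov

theorem momentMatrix_mean_sub_sampleMean {t : ℕ} (ht : t ≠ 0) :
    momentMatrix P (fun ω => meanOf D.atom p - sampleMean w t ω)
      = (1 / (t : ℝ)) • covariance D.atom p := by
  have hmemLp (s : ℕ) : MemLp (fun ω => w s ω - meanOf D.atom p) 2 P :=
    (h.memLp_w s).sub (memLp_const _)
  have hzero (s : ℕ) : ∫ ω, w s ω - meanOf D.atom p ∂P = 0 := by
    rw [integral_sub ((h.memLp_w s).integrable one_le_two) (integrable_const _), h.integral_w,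
      integral_const, probReal_univ, one_smul, sub_self]
  have hindep (s r : Fin t) (hsr : s ≠ r) :
      IndepFun (fun ω => w s ω - meanOf D.atom p) (fun ω => w r ω - meanOf D.atom p) P := by
    have hw : IndepFun (w s) (w r) P :=
      h.iIndepFun.indepFun (i := Sum.inr (Sum.inl s)) (j := Sum.inr (Sum.inl r))
        (by simpa [Fin.ext_iff] using hsr)
    exact hw.comp (measurable_id.sub_const _) (measurable_id.sub_const _)
  have hsum := momentMatrix_sum (s := Finset.univ)
    (X := fun (s : Fin t) ω => w s ω - meanOf D.atom p) (fun s _ => hmemLp s) (fun s _ => hzero s)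
    (fun s _ r _ hsr => hindep s r hsr)
  simp only [h.momentMatrix_w_sub_mean, Finset.sum_const, Finset.card_univ, Fintype.card_fin]
    at hsum
  simp only [mean_sub_sampleMean_eq w _ ht, momentMatrix_smul, hsum]
  rw [← Nat.cast_smul_eq_nsmul ℝ t, smul_smul]
  congr 1
  field_simp

theorem sum_integral_sampleMean_error (N : ℕ → Matrix (Fin n) (Fin n) ℝ) (T : ℕ) :
    ∑ t ∈ Finset.range (T + 1), ∫ ω, (meanOf D.atom p - sampleMean w t ω) ⬝ᵥ
        N t *ᵥ (meanOf D.atom p - sampleMean w t ω) ∂P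
      = (N 0 * vecMulVec (meanOf D.atom p) (meanOf D.atom p)).trace
        + ∑ t ∈ Finset.Icc 1 T, (1 / (t : ℝ)) * (N t * covariance D.atom p).trace := by
  rw [Finset.range_eq_Ico, Finset.sum_eq_sum_Ico_succ_bot (Nat.succ_pos T)]
  congr 1
  · simp [sampleMean, trace_mul_vecMulVec]
  · refine Finset.sum_congr rfl fun t ht => ?_
    have ht0 : t ≠ 0 := (Nat.succ_le_iff.1 (Finset.mem_Ico.1 ht).1).ne'
    have hdev : MemLp (fun ω => meanOf D.atom p - sampleMean w t ω) 2 P :=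
      (memLp_const _).sub (h.causalEstimate_sampleMean.memLp t)
    rw [(hasExpectation_quadratic (N t) hdev).integral_eq,
      h.momentMatrix_mean_sub_sampleMean ht0, Matrix.mul_smul, trace_smul, smul_eq_mul]

theorem integrable_costToGo_init (F : Matrix (Fin n) (Fin n) ℝ) (T : ℕ) (μ : Fin n → ℝ) :
    Integrable (fun ω => costToGo D T 0 μ (F *ᵥ (D.C *ᵥ x₀ ω + v 0 ω))) P :=
  integrable_costToGo (memLp_mulVec F ((memLp_mulVec D.C h.memLp_init).add (h.memLp_v 0))) μ

theorem costIntegrable_offlinePolicy (hC : IsUnit D.C.det) (T : ℕ) :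
    CostIntegrable P D (offlinePolicy D p T) x₀ w v T :=
  (isCertaintyEquivalent_offlinePolicy P D p T x₀ w v).costIntegrable hC
    (causalEstimate_const x₀ w v _) h

theorem cost_offlinePolicy (hC : IsUnit D.C.det) (hD : WeightsDefinite D) (T : ℕ) :
    cost P D (offlinePolicy D p T) x₀ w v T
      = (∫ ω, costToGo D T 0 (meanOf D.atom p) (D.C⁻¹ *ᵥ (D.C *ᵥ x₀ ω + v 0 ω)) ∂P)
        + hConst D p (D.C⁻¹ * momentMatrix P (v 0) * D.C⁻¹ᵀ) T := by
  rw [(isCertaintyEquivalent_offlinePolicy P D p T x₀ w v).cost_eq hC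
    (causalEstimate_const x₀ w v _) h hD]
  simp

section Regret

variable [NeZero M] (hC : IsUnit D.C.det) (hsep : Separated D v_b)
include hC hsep

theorem costIntegrable_learningPolicy (T : ℕ) :
    CostIntegrable P D (learningPolicy D T) x₀ w v T :=
  (h.isCertaintyEquivalent_learningPolicy hC hsep T).costIntegrable hC
    h.causalEstimate_sampleMean h

theorem cost_learningPolicy (hD : WeightsDefinite D) (T : ℕ) :
    cost P D (learningPolicy D T) x₀ w v T
      = (∫ ω, costToGo D T 0 (meanOf D.atom p) (D.C⁻¹ *ᵥ (D.C *ᵥ x₀ ω + v 0 ω)) ∂P)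
        + hConst D p (D.C⁻¹ * momentMatrix P (v 0) * D.C⁻¹ᵀ) T
        + (dMat D T 0 * vecMulVec (meanOf D.atom p) (meanOf D.atom p)).trace
        + ∑ t ∈ Finset.Icc 1 T, (1 / (t : ℝ)) * (dMat D T t * covariance D.atom p).trace := by
  rw [(h.isCertaintyEquivalent_learningPolicy hC hsep T).cost_eq hC
    h.causalEstimate_sampleMean h hD, h.sum_integral_sampleMean_error, ← add_assoc]

theorem quasiRegret_eq (hD : WeightsDefinite D) (T : ℕ) :
    quasiRegret P D p x₀ w v T
      = (dMat D T 0 * vecMulVec (meanOf D.atom p) (meanOf D.atom p)).trace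
        + ∑ t ∈ Finset.Icc 1 T, (1 / (t : ℝ)) * (dMat D T t * covariance D.atom p).trace := by
  rw [quasiRegret, h.cost_learningPolicy hC hsep hD, h.cost_offlinePolicy hC hD]
  ring

end Regret

end NoiseModel

end CostFormulas

section AffineRecursion

open Bornology

theorem bddAbove_range_of_le_half_add {a : ℕ → ℝ} {N k₀ : ℕ} {c : ℝ} (hN : N ≠ 0)
    (h : ∀ k ≥ k₀, a (k + N) ≤ a k / 2 + c) : BddAbove (Set.range a) := by
  obtain ⟨C, hC⟩ : BddAbove (a '' Set.Iio (k₀ + N)) := (Set.finite_Iio _).image a |>.bddAbove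
  refine ⟨max C (2 * c), Set.forall_mem_range.2 fun k => ?_⟩
  induction k using Nat.strong_induction_on with
  | _ k ih =>
    rcases lt_or_ge k (k₀ + N) with hk | hk
    · exact (hC ⟨k, hk, rfl⟩).trans (le_max_left _ _)
    · have hstep := h (k - N) (by lia)
      rw [Nat.sub_add_cancel (by lia)] at hstep
      linarith [ih (k - N) (by lia), le_max_right C (2 * c)]

variable {𝕜 E : Type*} [NontriviallyNormedField 𝕜] [SeminormedAddCommGroup E] [NormedSpace 𝕜 E]
  {G : ℕ → E →L[𝕜] E} {G' : E →L[𝕜] E} {b x : ℕ → E}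

theorem exists_tendsto_pow_isBounded_sub (hG : Tendsto G atTop (𝓝 G'))
    (hb : IsBounded (Set.range b)) (hx : ∀ k, x (k + 1) = G k (x k) + b k) (j : ℕ) :
    ∃ H : ℕ → E →L[𝕜] E, Tendsto H atTop (𝓝 (G' ^ j)) ∧
      IsBounded (Set.range fun k => x (k + j) - H k (x k)) := by
  obtain ⟨γ, hγ⟩ := hG.norm.bddAbove_range
  obtain ⟨β, hβ⟩ := isBounded_iff_forall_norm_le.1 hb
  induction j with
  | zero => exact ⟨fun _ => 1, by simpa using tendsto_const_nhds, by simp [Set.range_const]⟩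
  | succ j ih =>
    obtain ⟨H, hH, hbounded⟩ := ih
    obtain ⟨c, hc⟩ := isBounded_iff_forall_norm_le.1 hbounded
    refine ⟨fun k => G (k + j) * H k, ?_, isBounded_iff_forall_norm_le.2 ⟨γ * c + β, ?_⟩⟩
    · rw [pow_succ']
      exact (hG.comp (tendsto_add_atTop_nat j)).mul hH
    · rintro _ ⟨k, rfl⟩
      have hsucc : x (k + (j + 1)) - (G (k + j) * H k) (x k)
          = G (k + j) (x (k + j) - H k (x k)) + b (k + j) := by
        rw [← add_assoc, hx, map_sub, mul_apply_eq_comp]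
        abel
      calc ‖x (k + (j + 1)) - (G (k + j) * H k) (x k)‖
          ≤ ‖G (k + j) (x (k + j) - H k (x k))‖ + ‖b (k + j)‖ := hsucc ▸ norm_add_le _ _
        _ ≤ γ * c + β := add_le_add
            ((G (k + j)).le_of_opNorm_le_of_le (hγ ⟨_, rfl⟩) (hc _ ⟨k, rfl⟩)) (hβ _ ⟨_, rfl⟩)

theorem isBounded_range_of_affine_recursion (hG : Tendsto G atTop (𝓝 G'))
    (hG' : Tendsto (G' ^ ·) atTop (𝓝 0)) (hb : IsBounded (Set.range b))
    (hx : ∀ k, x (k + 1) = G k (x k) + b k) : IsBounded (Set.range x) := by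
  obtain ⟨N, hpow, hN⟩ : ∃ N : ℕ, ‖G' ^ N‖ < 1 / 2 ∧ N ≠ 0 :=
    ((hG'.norm.eventually (gt_mem_nhds (by simp))).and (eventually_ne_atTop 0)).exists
  obtain ⟨H, hH, hbounded⟩ := exists_tendsto_pow_isBounded_sub hG hb hx N
  obtain ⟨c, hc⟩ := isBounded_iff_forall_norm_le.1 hbounded
  obtain ⟨k₀, hk₀⟩ := eventually_atTop.1 (hH.norm.eventually (gt_mem_nhds hpow))
  obtain ⟨C, hC⟩ : BddAbove (Set.range fun k => ‖x k‖) := by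
    refine bddAbove_range_of_le_half_add (k₀ := k₀) (c := c) hN fun k hk => ?_
    calc ‖x (k + N)‖ = ‖H k (x k) + (x (k + N) - H k (x k))‖ := by rw [add_sub_cancel]
      _ ≤ ‖H k‖ * ‖x k‖ + c :=
          (norm_add_le _ _).trans (add_le_add ((H k).le_opNorm _) (hc _ ⟨k, rfl⟩))
      _ ≤ 1 / 2 * ‖x k‖ + c := by
          gcongr
          exact (hk₀ k hk).le
      _ = ‖x k‖ / 2 + c := by ring
  exact isBounded_iff_forall_norm_le.2 ⟨C, Set.forall_mem_range.2 fun k => hC ⟨k, rfl⟩⟩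

theorem mulLeftRight_pow {𝔸 : Type*} [SeminormedRing 𝔸] [NormedAlgebra 𝕜 𝔸] (a b : 𝔸) (k : ℕ) :
    ContinuousLinearMap.mulLeftRight 𝕜 𝔸 a b ^ k
      = ContinuousLinearMap.mulLeftRight 𝕜 𝔸 (a ^ k) (b ^ k) := by
  induction k with
  | zero => ext; simp
  | succ k ih =>
    ext y
    rw [pow_succ', ih, mul_apply_eq_comp]
    simp only [ContinuousLinearMap.mulLeftRight_apply, pow_succ' a, pow_succ b, mul_assoc]

theorem isBounded_range_comp_continuous {ι X Y : Type*} [PseudoMetricSpace X] [ProperSpace X]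
    [PseudoMetricSpace Y] {u : ι → X} (hu : IsBounded (Set.range u)) {f : X → Y}
    (hf : Continuous f) : IsBounded (Set.range fun i => f (u i)) :=
  (hu.isCompact_closure.image hf).isBounded.subset <|
    Set.range_subset_iff.2 fun i => ⟨u i, subset_closure ⟨i, rfl⟩, rfl⟩

end AffineRecursion

section Dissipation

variable {X : Type*} {f : X → X} {V d : X → ℝ}

theorem sum_dissipation_le (hV : ∀ x, 0 ≤ V x) (hstep : ∀ x, V x = V (f x) + d x) (x : X)
    (k : ℕ) : ∑ i ∈ Finset.range k, d (f^[i] x) ≤ V x := by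
  have hsum : ∑ i ∈ Finset.range k, d (f^[i] x) = V x - V (f^[k] x) := by
    refine (Finset.sum_congr rfl fun i _ => ?_).trans
      (Finset.sum_range_sub' (fun i => V (f^[i] x)) k)
    rw [hstep (f^[i] x), Function.iterate_succ_apply', add_sub_cancel_left]
  linarith [hV (f^[k] x)]

theorem dissipation_iterate_eq_zero (hV : ∀ x, 0 ≤ V x) (hd : ∀ x, 0 ≤ d x)
    (hstep : ∀ x, V x = V (f x) + d x) {x : X} (hx : V x = 0) (k : ℕ) : d (f^[k] x) = 0 := by
  refine le_antisymm ?_ (hd _)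
  calc d (f^[k] x) ≤ ∑ i ∈ Finset.range (k + 1), d (f^[i] x) :=
        Finset.single_le_sum (f := fun i => d (f^[i] x)) (fun i _ => hd _)
          (Finset.self_mem_range_succ k)
    _ ≤ 0 := hx ▸ sum_dissipation_le hV hstep x (k + 1)

-- LaSalle's invariance principle: the dissipation is summable along an orbit, hence vanishes
-- along the whole orbit of each of its cluster points.
theorem tendsto_iterate_of_dissipation [TopologicalSpace X] {x₀ : X} (hf : Continuous f)
    (hdc : Continuous d) (hV : ∀ x, 0 ≤ V x) (hd : ∀ x, 0 ≤ d x)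
    (hstep : ∀ x, V x = V (f x) + d x) (hcompact : ∀ c, IsCompact {x | V x ≤ c})
    (hunique : ∀ x, (∀ k, d (f^[k] x) = 0) → x = x₀) (x : X) :
    Tendsto (fun k => f^[k] x) atTop (𝓝 x₀) := by
  have hd0 : Tendsto (fun k => d (f^[k] x)) atTop (𝓝 0) :=
    (summable_of_sum_range_le (fun _ => hd _) (sum_dissipation_le hV hstep x)).tendsto_atTop_zero
  have hanti : Antitone fun k => V (f^[k] x) := antitone_nat_of_succ_le fun k => by
    rw [Function.iterate_succ_apply', hstep (f^[k] x)]
    exact le_add_of_nonneg_right (hd _)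
  refine (hcompact (V x)).tendsto_nhds_of_unique_mapClusterPt
    (Eventually.of_forall fun k => hanti k.zero_le) fun y _ hy => hunique y fun j => ?_
  have hcluster : MapClusterPt (d (f^[j] y)) atTop fun k => d (f^[j + k] x) := by
    simpa only [Function.comp_def, Function.iterate_add_apply] using
      hy.continuousAt_comp (hdc.comp (hf.iterate j)).continuousAt
  have hlim : Tendsto (fun k => d (f^[j + k] x)) atTop (𝓝 0) := by
    simpa only [Function.comp_def, add_comm j] using hd0.comp (tendsto_add_atTop_nat j)
  exact eq_of_nhds_neBot (hcluster.clusterPt.neBot.mono (inf_le_inf_left _ hlim))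

end Dissipation

section MatrixLimits

variable {ι κ : Type*}

theorem posSemidef_of_tendsto [Finite ι] {α : Type*} {l : Filter α} [l.NeBot]
    {Y : α → Matrix ι ι ℝ} {V : Matrix ι ι ℝ} (hY : Tendsto Y l (𝓝 V)) (h : ∀ a, (Y a).PosSemidef) :
    V.PosSemidef := by
  have := Fintype.ofFinite ι
  refine .of_dotProduct_mulVec_nonneg ?_ fun x => ?_
  · have hT := (continuous_id.matrix_transpose.tendsto V).comp hY
    simp only [Function.comp_def, id_eq, (isSymm_of_posSemidef (h _)).eq] at hT
    exact isHermitian_iff_isSymm.2 (tendsto_nhds_unique hT hY)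
  · have hquad : Continuous fun Z : Matrix ι ι ℝ => x ⬝ᵥ Z *ᵥ x := by fun_prop
    exact ge_of_tendsto' ((hquad.tendsto V).comp hY) fun a => quadratic_nonneg (h a) x

variable [Fintype ι]

open scoped MatrixOrder Matrix.Norms.L2Operator in
theorem isCompact_setOf_quadratic_le {V : Matrix ι ι ℝ} (hV : V.PosDef) (c : ℝ) :
    IsCompact {x : ι → ℝ | x ⬝ᵥ V *ᵥ x ≤ c} := by
  classical
  obtain ⟨N, rfl⟩ := CStarAlgebra.nonneg_iff_eq_star_mul_self.1 hV.posSemidef.nonneg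
  have hquad (x : ι → ℝ) : x ⬝ᵥ (star N * N) *ᵥ x = (N *ᵥ x) ⬝ᵥ (N *ᵥ x) := by
    rw [star_eq_conjTranspose, conjTranspose_eq_transpose_of_trivial, ← mulVec_mulVec,
      mulVec_dotProduct_eq_dotProduct_transpose_mulVec]
  have hker : LinearMap.ker N.mulVecLin = ⊥ := LinearMap.ker_eq_bot'.2 fun x hx => by
    by_contra hx0
    have hpos := hV.dotProduct_mulVec_pos hx0
    rw [star_trivial, hquad, ← mulVecLin_apply, hx] at hpos
    simp at hpos
  have hball : IsCompact {y : ι → ℝ | y ⬝ᵥ y ≤ c} := by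
    refine (isCompact_closedBall 0 √c).of_isClosed_subset
      (isClosed_le (by fun_prop) continuous_const) fun y hy => ?_
    rw [mem_closedBall_zero_iff, pi_norm_le_iff_of_nonneg (Real.sqrt_nonneg c)]
    refine fun i => Real.abs_le_sqrt ?_
    rw [sq]
    exact (Finset.single_le_sum (f := fun i => y i * y i) (fun i _ => mul_self_nonneg _)
      (Finset.mem_univ i)).trans hy
  simp only [hquad]
  exact (LinearMap.isClosedEmbedding_of_injective hker).isCompact_preimage hball

theorem iterate_mulVec [DecidableEq ι] (F : Matrix ι ι ℝ) (k : ℕ) (x : ι → ℝ) :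
    (F *ᵥ ·)^[k] x = F ^ k *ᵥ x := by
  induction k with
  | zero => simp
  | succ k ih => rw [Function.iterate_succ_apply', ih, mulVec_mulVec, pow_succ']

theorem tendsto_of_tendsto_mulVec {α : Type*} {l : Filter α} {F : α → Matrix κ ι ℝ}
    {F' : Matrix κ ι ℝ} (h : ∀ x, Tendsto (F · *ᵥ x) l (𝓝 (F' *ᵥ x))) : Tendsto F l (𝓝 F') :=
  tendsto_pi_nhds.2 fun i => tendsto_pi_nhds.2 fun j => by
    classical
    simpa [mulVec_single_one] using tendsto_pi_nhds.1 (h (Pi.single j 1)) i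

theorem tendsto_pow_of_dissipation [DecidableEq ι] {F V W : Matrix ι ι ℝ} (hV : V.PosSemidef)
    (hW : W.PosSemidef) (hstep : ∀ x, x ⬝ᵥ V *ᵥ x = (F *ᵥ x) ⬝ᵥ V *ᵥ (F *ᵥ x) + x ⬝ᵥ W *ᵥ x)
    (hobs : ∀ x, (∀ k : ℕ, W *ᵥ (F ^ k *ᵥ x) = 0) → x = 0) :
    Tendsto (F ^ ·) atTop (𝓝 0) := by
  have hunique (x : ι → ℝ) (h : ∀ k, (F *ᵥ ·)^[k] x ⬝ᵥ W *ᵥ (F *ᵥ ·)^[k] x = 0) : x = 0 :=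
    hobs x fun k => iterate_mulVec F k x ▸ (hW.dotProduct_mulVec_zero_iff _).1 (h k)
  have hVpos : V.PosDef := .of_dotProduct_mulVec_pos hV.isHermitian fun x hx =>
    (quadratic_nonneg hV x).lt_of_ne fun h => hx <| hunique x <|
      dissipation_iterate_eq_zero (d := fun x => x ⬝ᵥ W *ᵥ x) (quadratic_nonneg hV)
        (quadratic_nonneg hW) hstep h.symm
  refine tendsto_of_tendsto_mulVec fun x => ?_
  simpa only [zero_mulVec, iterate_mulVec] using
    tendsto_iterate_of_dissipation (d := fun x => x ⬝ᵥ W *ᵥ x) (f := (F *ᵥ ·)) (by fun_prop)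
      (by fun_prop) (quadratic_nonneg hV) (quadratic_nonneg hW) hstep
      (isCompact_setOf_quadratic_le hVpos) hunique x

theorem exists_tendsto_of_quadratic {α : Type*} {l : Filter α} {Y : α → Matrix ι ι ℝ}
    (hY : ∀ a, (Y a).IsSymm) (h : ∀ x, ∃ q, Tendsto (fun a => x ⬝ᵥ Y a *ᵥ x) l (𝓝 q)) :
    ∃ V, Tendsto Y l (𝓝 V) := by
  classical
  choose q hq using h
  refine ⟨.of fun i j => (q (Pi.single i 1 + Pi.single j 1) - q (Pi.single i 1)
    - q (Pi.single j 1)) / 2, tendsto_pi_nhds.2 fun i => tendsto_pi_nhds.2 fun j => ?_⟩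
  refine (((hq _).sub (hq _)).sub (hq _)).div_const 2 |>.congr fun a => ?_
  rw [quadratic_add (hY a)]
  simp only [single_one_dotProduct, mulVec_single_one, col_apply]
  ring

theorem continuousAt_matrix_mul {ν X : Type*} [TopologicalSpace X] {f : X → Matrix κ ι ℝ}
    {g : X → Matrix ι ν ℝ} {x : X} (hf : ContinuousAt f x) (hg : ContinuousAt g x) :
    ContinuousAt (fun y => f y * g y) x :=
  (continuous_fst.matrix_mul continuous_snd).continuousAt.comp (hf.prodMk hg)

end MatrixLimits

section RiccatiIteration

variable {ι κ : Type*} [Fintype ι] [Fintype κ] [DecidableEq κ]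

/-- The cost-to-go matrix of the time-invariant linear-quadratic problem with zero terminal weight
and `k` stages to go. -/
def riccatiIter (A : Matrix ι ι ℝ) (B : Matrix ι κ ℝ) (Q : Matrix ι ι ℝ) (R : Matrix κ κ ℝ)
    (k : ℕ) : Matrix ι ι ℝ :=
  (riccatiMap A B Q R)^[k] 0

/-- The matrix `L_T(t)` of the time-invariant problem with zero terminal weight, as a function of
the number `k = T + 1 - t` of stages to go. -/
def adjointIter (A : Matrix ι ι ℝ) (B : Matrix ι κ ℝ) (Q : Matrix ι ι ℝ) (R : Matrix κ κ ℝ) :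
    ℕ → Matrix ι ι ℝ
  | 0 => 0
  | k + 1 => (closedLoop A B R (riccatiIter A B Q R k))ᵀ
      * (riccatiIter A B Q R k + adjointIter A B Q R k)

variable {A Q V P P' : Matrix ι ι ℝ} {B : Matrix ι κ ℝ} {R : Matrix κ κ ℝ}

theorem riccatiIter_succ (k : ℕ) :
    riccatiIter A B Q R (k + 1) = riccatiMap A B Q R (riccatiIter A B Q R k) :=
  Function.iterate_succ_apply' _ _ _

theorem riccatiIter_posSemidef (hQ : Q.PosSemidef) (hR : R.PosDef) (k : ℕ) :
    (riccatiIter A B Q R k).PosSemidef := by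
  induction k with
  | zero => exact .zero
  | succ k ih =>
    rw [riccatiIter_succ]
    exact riccatiMap_posSemidef ih hQ hR

theorem riccatiMap_quadratic_mono (hP : P.PosSemidef) (hP' : P'.PosSemidef) (hR : R.PosDef)
    (h : ∀ x, x ⬝ᵥ P *ᵥ x ≤ x ⬝ᵥ P' *ᵥ x) (x : ι → ℝ) :
    x ⬝ᵥ riccatiMap A B Q R P *ᵥ x ≤ x ⬝ᵥ riccatiMap A B Q R P' *ᵥ x := by
  refine (riccatiMap_quadratic_le hP hR x (-(riccatiGain A B R P' *ᵥ x))).trans ?_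
  rw [mulVec_add_mulVec_neg_riccatiGain, mulVec_neg, neg_dotProduct_neg,
    riccatiMap_quadratic_eq_closedLoop hP' hR]
  exact (add_le_add_iff_left _).2 (h _)

theorem riccatiIter_quadratic_monotone (hQ : Q.PosSemidef) (hR : R.PosDef) (x : ι → ℝ) :
    Monotone fun k => x ⬝ᵥ riccatiIter A B Q R k *ᵥ x := by
  refine monotone_nat_of_le_succ fun k => ?_
  induction k generalizing x with
  | zero => simpa [riccatiIter] using quadratic_nonneg (riccatiMap_posSemidef .zero hQ hR) x
  | succ k ih =>
    simpa only [riccatiIter_succ] using riccatiMap_quadratic_mono (riccatiIter_posSemidef hQ hR k)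
      (riccatiIter_posSemidef hQ hR (k + 1)) hR ih x

theorem continuousAt_inputWeight_inv (hV : V.PosSemidef) (hR : R.PosDef) :
    ContinuousAt (fun P => (inputWeight B R P)⁻¹) V := by
  have hcont : Continuous (inputWeight B R) := by unfold inputWeight; fun_prop
  refine (continuousAt_matrix_inv _ ?_).comp hcont.continuousAt
  rw [Ring.inverse_eq_inv']
  exact continuousAt_inv₀ (isUnit_det_inputWeight hV hR).ne_zero

theorem continuousAt_riccatiGain (hV : V.PosSemidef) (hR : R.PosDef) :
    ContinuousAt (riccatiGain A B R) V :=
  continuousAt_matrix_mul (continuousAt_inputWeight_inv hV hR) (by fun_prop)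

theorem continuousAt_closedLoop (hV : V.PosSemidef) (hR : R.PosDef) :
    ContinuousAt (closedLoop A B R) V :=
  continuousAt_const.sub (continuousAt_matrix_mul continuousAt_const
    (continuousAt_riccatiGain hV hR))

theorem continuousAt_riccatiMap (hV : V.PosSemidef) (hR : R.PosDef) :
    ContinuousAt (riccatiMap A B Q R) V :=
  .sub (by fun_prop) (continuousAt_matrix_mul (by fun_prop) (continuousAt_riccatiGain hV hR))

theorem riccatiMap_eq_self_of_tendsto_riccatiIter (hQ : Q.PosSemidef) (hR : R.PosDef)
    (hV : Tendsto (riccatiIter A B Q R) atTop (𝓝 V)) : riccatiMap A B Q R V = V := by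
  have hcont := continuousAt_riccatiMap (A := A) (B := B) (Q := Q)
    (posSemidef_of_tendsto hV (riccatiIter_posSemidef hQ hR)) hR
  refine tendsto_nhds_unique (hcont.tendsto.comp hV) ?_
  simpa only [Function.comp_def, riccatiIter_succ] using hV.comp (tendsto_add_atTop_nat 1)

theorem tendsto_closedLoop_pow [DecidableEq ι] (hQ : Q.PosSemidef) (hR : R.PosDef)
    (hV : V.PosSemidef) (hfix : riccatiMap A B Q R V = V)
    (hobs : ∀ x, (∀ k : ℕ, Q *ᵥ (A ^ k *ᵥ x) = 0) → x = 0) :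
    Tendsto (closedLoop A B R V ^ ·) atTop (𝓝 0) := by
  set K := riccatiGain A B R V
  have hKRK : (Kᵀ * R * K).PosSemidef := posSemidef_transpose_mul_mul hR.posSemidef K
  have hker (x : ι → ℝ) (h : (Q + Kᵀ * R * K) *ᵥ x = 0) : Q *ᵥ x = 0 ∧ K *ᵥ x = 0 := by
    have hsum : x ⬝ᵥ Q *ᵥ x + x ⬝ᵥ (Kᵀ * R * K) *ᵥ x = 0 := by
      rw [← dotProduct_add, ← add_mulVec, h, dotProduct_zero]
    obtain ⟨hQx, hKx⟩ := (add_eq_zero_iff_of_nonneg (quadratic_nonneg hQ x)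
      (quadratic_nonneg hKRK x)).1 hsum
    refine ⟨(hQ.dotProduct_mulVec_zero_iff x).1 hQx, ?_⟩
    by_contra hne
    rw [← mulVec_dotProduct_mulVec_mulVec] at hKx
    exact (hR.dotProduct_mulVec_pos hne).ne' hKx
  have hopen (x : ι → ℝ) (h : (Q + Kᵀ * R * K) *ᵥ x = 0) : closedLoop A B R V *ᵥ x = A *ᵥ x := by
    rw [closedLoop, sub_mulVec, ← mulVec_mulVec, (hker x h).2, mulVec_zero, sub_zero]
  refine tendsto_pow_of_dissipation hV (hQ.add hKRK) (fun x => ?_) fun x hx => hobs x fun k => ?_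
  · conv_lhs => rw [← hfix, riccatiMap_quadratic_eq_closedLoop hV hR]
    rw [add_mulVec, dotProduct_add, ← mulVec_dotProduct_mulVec_mulVec]
    ring
  · have hpow : closedLoop A B R V ^ k *ᵥ x = A ^ k *ᵥ x := by
      induction k with
      | zero => simp
      | succ k ih =>
        rw [pow_succ', ← mulVec_mulVec, hopen _ (hx k), ih, mulVec_mulVec, pow_succ']
    exact hpow ▸ (hker _ (hx k)).1

end RiccatiIteration

section RiccatiConvergence

open Bornology

variable {ι κ : Type*} [Fintype ι] [Fintype κ] [DecidableEq κ]
  {A Q V F W : Matrix ι ι ℝ} {B : Matrix ι κ ℝ} {R : Matrix κ κ ℝ}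

theorem riccatiIter_quadratic_le_lyapunov (hQ : Q.PosSemidef) (hR : R.PosDef) (K : Matrix κ ι ℝ)
    (k : ℕ) (x : ι → ℝ) :
    x ⬝ᵥ riccatiIter A B Q R k *ᵥ x
      ≤ x ⬝ᵥ (fun Y => (A + B * K)ᵀ * Y * (A + B * K) + (Q + Kᵀ * R * K))^[k] 0 *ᵥ x := by
  induction k generalizing x with
  | zero => rfl
  | succ k ih =>
    rw [riccatiIter_succ, Function.iterate_succ_apply']
    refine (riccatiMap_quadratic_le (riccatiIter_posSemidef hQ hR k) hR x (K *ᵥ x)).trans ?_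
    rw [mulVec_mulVec x B, ← add_mulVec, add_mulVec (_ * _), add_mulVec Q, dotProduct_add,
      dotProduct_add, ← mulVec_dotProduct_mulVec_mulVec, ← mulVec_dotProduct_mulVec_mulVec]
    linarith [ih ((A + B * K) *ᵥ x)]

variable [DecidableEq ι]

open scoped Matrix.Norms.L2Operator in
theorem isBounded_range_lyapunov_iterate (hF : Tendsto (F ^ ·) atTop (𝓝 0)) :
    IsBounded (Set.range fun k => (fun Y => Fᵀ * Y * F + W)^[k] 0) := by
  have hpow : Tendsto (ContinuousLinearMap.mulLeftRight ℝ (Matrix ι ι ℝ) Fᵀ F ^ ·) atTop (𝓝 0) := by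
    simp only [mulLeftRight_pow]
    have hcont : Continuous fun Y : Matrix ι ι ℝ =>
        ContinuousLinearMap.mulLeftRight ℝ (Matrix ι ι ℝ) Yᵀ Y := by fun_prop
    simpa [Function.comp_def] using (hcont.tendsto 0).comp hF
  refine isBounded_range_of_affine_recursion tendsto_const_nhds hpow (b := fun _ => W)
    (by simp [Set.range_const]) fun k => ?_
  rw [Function.iterate_succ_apply', ContinuousLinearMap.mulLeftRight_apply]

open scoped Matrix.Norms.L2Operator in
theorem exists_tendsto_riccatiIter (hQ : Q.PosSemidef) (hR : R.PosDef) {K : Matrix κ ι ℝ}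
    (hK : Tendsto ((A + B * K) ^ ·) atTop (𝓝 0)) :
    ∃ V, Tendsto (riccatiIter A B Q R) atTop (𝓝 V) := by
  refine exists_tendsto_of_quadratic
    (fun k => isSymm_of_posSemidef (riccatiIter_posSemidef hQ hR k)) fun x =>
    ⟨_, tendsto_atTop_ciSup (riccatiIter_quadratic_monotone hQ hR x) ?_⟩
  have : ProperSpace (Matrix ι ι ℝ) := FiniteDimensional.proper_real _
  obtain ⟨c, hc⟩ := (isBounded_range_comp_continuous (f := fun Y => x ⬝ᵥ Y *ᵥ x)
    (isBounded_range_lyapunov_iterate (W := Q + Kᵀ * R * K) hK) (by fun_prop)).bddAbove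
  exact ⟨c, Set.forall_mem_range.2 fun k =>
    (riccatiIter_quadratic_le_lyapunov hQ hR K k x).trans (hc ⟨k, rfl⟩)⟩

open scoped Matrix.Norms.L2Operator in
theorem isBounded_range_adjointIter (hR : R.PosDef) (hV : V.PosSemidef)
    (hlim : Tendsto (riccatiIter A B Q R) atTop (𝓝 V))
    (hpow : Tendsto (closedLoop A B R V ^ ·) atTop (𝓝 0)) :
    IsBounded (Set.range (adjointIter A B Q R)) := by
  have hloop : Tendsto (fun k => (closedLoop A B R (riccatiIter A B Q R k))ᵀ) atTop
      (𝓝 (closedLoop A B R V)ᵀ) :=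
    (continuous_id.matrix_transpose.tendsto _).comp
      ((continuousAt_closedLoop hV hR).tendsto.comp hlim)
  have hmul : Continuous fun Y : Matrix ι ι ℝ =>
      ContinuousLinearMap.mulLeftRight ℝ (Matrix ι ι ℝ) Y 1 := by fun_prop
  refine isBounded_range_of_affine_recursion ((hmul.tendsto _).comp hloop) ?_
    (Metric.isBounded_range_of_tendsto _ (hloop.mul hlim)) fun k => ?_
  · simp only [mulLeftRight_pow, one_pow]
    simpa [Function.comp_def] using ((hmul.comp continuous_id.matrix_transpose).tendsto 0).comp hpow
  · rw [adjointIter, Matrix.mul_add, add_comm]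
    simp

end RiccatiConvergence

section PenaltyIteration

open Bornology

variable {ι κ : Type*} [Fintype ι] [Fintype κ] [DecidableEq κ]
  {A Q : Matrix ι ι ℝ} {B : Matrix ι κ ℝ} {R : Matrix κ κ ℝ} {K : Matrix κ ι ℝ}

/-- The matrix `D_T(t)` of the time-invariant problem with zero terminal weight, as a function of
`k = T - t`. -/
def dIter (A : Matrix ι ι ℝ) (B : Matrix ι κ ℝ) (Q : Matrix ι ι ℝ) (R : Matrix κ κ ℝ)
    (k : ℕ) : Matrix ι ι ℝ :=
  (Bᵀ * (riccatiIter A B Q R k + adjointIter A B Q R k))ᵀ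
    * (inputWeight B R (riccatiIter A B Q R k))⁻¹
    * (Bᵀ * (riccatiIter A B Q R k + adjointIter A B Q R k))

open scoped Matrix.Norms.L2Operator in
theorem isBounded_range_dIter [DecidableEq ι] (hQ : Q.PosSemidef) (hR : R.PosDef)
    (hK : Tendsto ((A + B * K) ^ ·) atTop (𝓝 0))
    (hobs : ∀ x, (∀ k : ℕ, Q *ᵥ (A ^ k *ᵥ x) = 0) → x = 0) :
    IsBounded (Set.range (dIter A B Q R)) := by
  obtain ⟨V, hlim⟩ := exists_tendsto_riccatiIter (Q := Q) hQ hR hK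
  have hV : V.PosSemidef := posSemidef_of_tendsto hlim (riccatiIter_posSemidef hQ hR)
  have hadjoint : IsBounded (Set.range (adjointIter A B Q R)) :=
    isBounded_range_adjointIter hR hV hlim <|
      tendsto_closedLoop_pow hQ hR hV (riccatiMap_eq_self_of_tendsto_riccatiIter hQ hR hlim) hobs
  have hinv : IsBounded (Set.range fun k => (inputWeight B R (riccatiIter A B Q R k))⁻¹) :=
    Metric.isBounded_range_of_tendsto _ ((continuousAt_inputWeight_inv hV hR).tendsto.comp hlim)
  have hpair : IsBounded (Set.range fun k => (riccatiIter A B Q R k, adjointIter A B Q R k,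
      (inputWeight B R (riccatiIter A B Q R k))⁻¹)) :=
    ((Metric.isBounded_range_of_tendsto _ hlim).prod (hadjoint.prod hinv)).subset <|
      Set.range_subset_iff.2 fun k => ⟨⟨k, rfl⟩, ⟨k, rfl⟩, ⟨k, rfl⟩⟩
  have : ProperSpace (Matrix ι ι ℝ) := FiniteDimensional.proper_real _
  have : ProperSpace (Matrix κ κ ℝ) := FiniteDimensional.proper_real _
  exact isBounded_range_comp_continuous hpair
    (f := fun Z => (Bᵀ * (Z.1 + Z.2.1))ᵀ * Z.2.2 * (Bᵀ * (Z.1 + Z.2.1))) (by fun_prop)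

end PenaltyIteration

section TimeInvariant

variable {n m M : ℕ} {D : Model n m M}

theorem Observable.mul_self {A S : Matrix (Fin n) (Fin n) ℝ} (h : Observable A S)
    (hS : S.PosSemidef) : Observable A (S * S) := fun z hz => h z fun k => by
  rw [← dotProduct_self_eq_zero, mulVec_dotProduct_eq_dotProduct_transpose_mulVec,
    (isSymm_of_posSemidef hS).eq, mulVec_mulVec, hz k, dotProduct_zero]

variable (D) in
/-- Hypothesis (H1): the weights do not depend on time and the terminal weight vanishes for every
horizon. -/
structure TimeInvariant : Prop where
  state_eq : ∀ t, D.Q t = D.Q 0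
  input_eq : ∀ t, D.R t = D.R 0
  terminal_eq_zero : ∀ T, D.Pterm T = 0

namespace TimeInvariant

variable (h : TimeInvariant D)
include h

theorem riccati_eq_riccatiIter {T t k : ℕ} (hk : t + k = T + 1) :
    riccati D T t = riccatiIter D.A D.B (D.Q 0) (D.R 0) k := by
  induction k generalizing t with
  | zero => rw [show t = T + 1 by lia, riccati_terminal, h.terminal_eq_zero]; rfl
  | succ k ih =>
    rw [riccati_of_le D (by lia), ih (by lia), h.state_eq, h.input_eq, riccatiIter_succ]

theorem adjointL_eq_adjointIter (hD : WeightsDefinite D) {T t k : ℕ} (hk : t + k = T + 1) :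
    adjointL D T t = adjointIter D.A D.B (D.Q 0) (D.R 0) k := by
  induction k generalizing t with
  | zero => rw [show t = T + 1 by lia, adjointL_terminal, adjointIter]
  | succ k ih =>
    rw [hD.adjointL_of_le (by lia), ih (by lia), h.riccati_eq_riccatiIter (k := k) (by lia),
      h.input_eq, adjointIter]

theorem dMat_eq_dIter (hD : WeightsDefinite D) {T t : ℕ} (ht : t ≤ T) :
    dMat D T t = dIter D.A D.B (D.Q 0) (D.R 0) (T - t) := by
  have hk : t + 1 + (T - t) = T + 1 := by lia
  rw [dMat_eq_transpose_mul_mul, dIter, ← h.riccati_eq_riccatiIter hk,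
    ← h.adjointL_eq_adjointIter hD hk, ← h.input_eq t]
  rfl

open scoped Matrix.Norms.L2Operator in
theorem exists_abs_trace_dMat_mul_le (hD : WeightsDefinite D) (hstab : Stabilizable D.A D.B)
    (hobs : Observable D.A (D.Q 0)) (S : Matrix (Fin n) (Fin n) ℝ) :
    ∃ c, ∀ T, ∀ t ≤ T, |(dMat D T t * S).trace| ≤ c := by
  obtain ⟨K, hK⟩ := hstab
  have hbounded := isBounded_range_dIter (hD.state_posSemidef 0) (hD.input_posDef 0)
    (tendsto_of_tendsto_mulVec (F' := 0) (by simpa only [zero_mulVec] using hK)) hobs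
  have : ProperSpace (Matrix (Fin n) (Fin n) ℝ) := FiniteDimensional.proper_real _
  obtain ⟨c, hc⟩ := Bornology.IsBounded.exists_norm_le (isBounded_range_comp_continuous hbounded
    (f := fun Z => (Z * S).trace) (by fun_prop))
  exact ⟨c, fun T t ht => h.dMat_eq_dIter hD ht ▸ hc _ ⟨T - t, rfl⟩⟩

end TimeInvariant

theorem isBigO_log_add_sum_one_div_mul {a : ℕ → ℝ} {g : ℕ → ℕ → ℝ} {c₁ c₂ : ℝ}
    (ha : ∀ T, |a T| ≤ c₁) (hg : ∀ T, ∀ t ≤ T, |g T t| ≤ c₂) :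
    (fun T => a T + ∑ t ∈ Finset.Icc 1 T, 1 / (t : ℝ) * g T t)
      =O[atTop] fun T : ℕ => Real.log T := by
  have hconst (c : ℝ) : (fun _ : ℕ => c) =O[atTop] fun T : ℕ => Real.log T :=
    (Real.isLittleO_const_log_atTop.comp_tendsto tendsto_natCast_atTop_atTop).isBigO
  have hharmonic : (fun T => (harmonic T : ℝ)) =O[atTop] fun T : ℕ => Real.log T := by
    refine .trans (.of_bound 1 (.of_forall fun T => ?_))
      ((hconst 1).add (Asymptotics.isBigO_refl _ _))
    have hnonneg : (0 : ℝ) ≤ harmonic T := by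
      simp only [harmonic, Rat.cast_sum]
      positivity
    rw [one_mul, Real.norm_of_nonneg hnonneg]
    exact (harmonic_le_one_add_log T).trans (le_abs_self _)
  refine .add (.trans (.of_bound 1 (.of_forall fun T => ?_)) (hconst c₁))
    (.trans (.of_bound c₂ (.of_forall fun T => ?_)) hharmonic)
  · simpa using (ha T).trans (le_abs_self c₁)
  · calc ‖∑ t ∈ Finset.Icc 1 T, 1 / (t : ℝ) * g T t‖
        ≤ ∑ t ∈ Finset.Icc 1 T, 1 / (t : ℝ) * c₂ := norm_sum_le_of_le _ fun t ht => by
          rw [norm_mul, Real.norm_of_nonneg (by positivity)]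
          gcongr
          exact hg T t (Finset.mem_Icc.1 ht).2
      _ = c₂ * harmonic T := by
          rw [← Finset.sum_mul, mul_comm, harmonic_eq_sum_Icc]
          simp
      _ ≤ c₂ * ‖(harmonic T : ℝ)‖ := by
          gcongr
          · exact (abs_nonneg _).trans (hg T 0 T.zero_le)
          · exact le_abs_self _

variable {Ω : Type*} [MeasurableSpace Ω] {P : Measure Ω} [IsProbabilityMeasure P] [NeZero M]
  {p : Fin M → ℝ} {x₀ : Ω → Fin n → ℝ} {w v : ℕ → Ω → Fin n → ℝ} {v_b : ℝ}

theorem NoiseModel.quasiRegret_isBigO_log (h : NoiseModel P D p x₀ w v v_b)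
    (hC : IsUnit D.C.det) (hsep : Separated D v_b) (hD : WeightsDefinite D)
    (htime : TimeInvariant D) (hstab : Stabilizable D.A D.B) (hobs : Observable D.A (D.Q 0)) :
    (fun T => quasiRegret P D p x₀ w v T) =O[atTop] fun T : ℕ => Real.log T := by
  obtain ⟨c₁, hc₁⟩ := htime.exists_abs_trace_dMat_mul_le hD hstab hobs
    (vecMulVec (meanOf D.atom p) (meanOf D.atom p))
  obtain ⟨c₂, hc₂⟩ := htime.exists_abs_trace_dMat_mul_le hD hstab hobs (covariance D.atom p)
  simpa only [h.quasiRegret_eq hC hsep hD] using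
    isBigO_log_add_sum_one_div_mul (fun T => hc₁ T 0 T.zero_le) hc₂

end TimeInvariant

end OutputFeedback

end

open OutputFeedback in
theorem theorem5_general {n m M : ℕ} [NeZero M] {Ω : Type*} [MeasurableSpace Ω]
    {P : Measure Ω} [IsProbabilityMeasure P] {D : Model n m M} (hC : IsUnit D.C.det)
    (hD : WeightsDefinite D) {p : Fin M → ℝ} {x₀ : Ω → Fin n → ℝ} {w v : ℕ → Ω → Fin n → ℝ}
    {v_b : ℝ} (hnoise : NoiseModel P D p x₀ w v v_b) (hsep : Separated D v_b) :
    (∀ T, ∀ᵐ ω ∂P, ∀ t,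
      (∀ i, (∀ j,
          vecNorm
              (noiseEst D (learningPolicy D T) x₀ w v t ω - D.atom i)
            ≤ vecNorm
              (noiseEst D (learningPolicy D T) x₀ w v t ω
                - D.atom j))
        ↔ w t ω = D.atom i) ∧
      (∀ i, historyProbEst D t
          (fun s => output D (learningPolicy D T) x₀ w v s ω)
          (fun s => input D (learningPolicy D T) x₀ w v s ω) i
        = ({s : Fin t | w s ω = D.atom i}.ncard : ℝ) / t)) ∧
    (∀ T,
      (∀ t ≤ T, (dMat D T t).PosSemidef) ∧
      CostIntegrable P D (learningPolicy D T) x₀ w v T ∧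
      Integrable (fun ω =>
        (D.C⁻¹ *ᵥ (D.C *ᵥ x₀ ω + v 0 ω)) ⬝ᵥ
            (riccati D T 0 *ᵥ (D.C⁻¹ *ᵥ (D.C *ᵥ x₀ ω + v 0 ω)))
          + 2 * ((D.C⁻¹ *ᵥ (D.C *ᵥ x₀ ω + v 0 ω)) ⬝ᵥ
            (adjointL D T 0 *ᵥ meanOf D.atom p))) P ∧
      cost P D (learningPolicy D T) x₀ w v T
        = ∫ ω, ((D.C⁻¹ *ᵥ (D.C *ᵥ x₀ ω + v 0 ω)) ⬝ᵥ
              (riccati D T 0 *ᵥ (D.C⁻¹ *ᵥ (D.C *ᵥ x₀ ω + v 0 ω)))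
            + 2 * ((D.C⁻¹ *ᵥ (D.C *ᵥ x₀ ω + v 0 ω)) ⬝ᵥ
              (adjointL D T 0 *ᵥ meanOf D.atom p))) ∂P
          + hConst D p
              (D.C⁻¹ * momentMatrix P (v 0) * (D.C⁻¹)ᵀ) T
          + (dMat D T 0 * vecMulVec (meanOf D.atom p)
              (meanOf D.atom p)).trace
          + ∑ t ∈ Finset.Icc 1 T, (1 / (t : ℝ)) *
              (dMat D T t * covariance D.atom p).trace) ∧
    (∀ T,
      CostIntegrable P D (offlinePolicy D p T) x₀ w v T ∧
      quasiRegret P D p x₀ w v T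
        = (dMat D T 0 * vecMulVec (meanOf D.atom p)
              (meanOf D.atom p)).trace
          + ∑ t ∈ Finset.Icc 1 T, (1 / (t : ℝ)) *
              (dMat D T t * covariance D.atom p).trace) ∧
    ((∀ t, D.Q t = D.Q 0) → (∀ t, D.R t = D.R 0) → (∀ T, D.Pterm T = 0) →
      Stabilizable D.A D.B →
      (∃ S : Matrix (Fin n) (Fin n) ℝ, S.PosSemidef ∧ S * S = D.Q 0 ∧
        Observable D.A S) →
      (fun T : ℕ => quasiRegret P D p x₀ w v T)
        =O[atTop] (fun T : ℕ => Real.log T)) :=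
  ⟨fun T => hnoise.ae_exact_identification hC hsep (learningPolicy D T),
    fun T => ⟨fun t _ => hD.dMat_posSemidef T t, hnoise.costIntegrable_learningPolicy hC hsep T,
      hnoise.integrable_costToGo_init D.C⁻¹ T _, hnoise.cost_learningPolicy hC hsep hD T⟩,
    fun T => ⟨hnoise.costIntegrable_offlinePolicy hC T, hnoise.quasiRegret_eq hC hsep hD T⟩,
    fun hQ hR hPterm hstab ⟨_, hS, hSQ, hobs⟩ => hnoise.quasiRegret_isBigO_log hC hsep hD
      ⟨hQ, hR, hPterm⟩ hstab (hSQ ▸ hobs.mul_self hS)⟩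

theorem theorem5 {n m M : ℕ} [NeZero M] {Ω : Type*} [MeasurableSpace Ω]
    (P : Measure Ω) [IsProbabilityMeasure P]
    (D : OutputFeedback.Model n m M)
    -- the measurement matrix is nonsingular; the weights are (semi)definite
    (hC : IsUnit D.C.det)
    (hQ : ∀ t, (D.Q t).PosSemidef) (hR : ∀ t, (D.R t).PosDef)
    (hPterm : ∀ T, (D.Pterm T).PosSemidef)
    -- the unknown noise probabilities, the noises and the initial state
    (p : Fin M → ℝ) (hp : p ∈ stdSimplex ℝ (Fin M))
    (x₀ : Ω → Fin n → ℝ) (w v : ℕ → Ω → Fin n → ℝ) (v_b : ℝ)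
    (hx₀_meas : Measurable x₀) (hx₀ : HasGaussianLaw x₀ P)
    (hw_meas : ∀ t, Measurable (w t))
    (hw : ∀ t, P.map (w t) = ∑ i, ENNReal.ofReal (p i) • Measure.dirac (D.atom i))
    (hv_meas : ∀ t, Measurable (v t)) (hv_ident : ∀ t, IdentDistrib (v t) (v 0) P P)
    (hv_bdd : ∀ t, ∀ᵐ ω ∂P, OutputFeedback.vecNorm (v t ω) ≤ v_b)
    (hv_mean : ∫ ω, v 0 ω ∂P = 0)
    (hindep : iIndepFun (Sum.elim (fun _ : Unit => x₀) (Sum.elim w v)) P)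
    -- separation of the values of the system noise
    (hsep : ∀ i j, i ≠ j →
      2 * (1 + OutputFeedback.opNorm D.A) * OutputFeedback.opNorm D.C⁻¹ * v_b
        < OutputFeedback.vecNorm (D.atom i - D.atom j)) :
    -- the system noise is identified exactly: almost surely, for every `t`, the minimizers of
    -- the distance to `ŵ(t)` are exactly the indices of the true value `w(t)`, and hence the
    -- estimate computed by the policy is the empirical frequency of the true noise values
    (∀ T, ∀ᵐ ω ∂P, ∀ t,
      (∀ i, (∀ j,
          OutputFeedback.vecNorm
              (OutputFeedback.noiseEst D (OutputFeedback.learningPolicy D T) x₀ w v t ω - D.atom i)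
            ≤ OutputFeedback.vecNorm
              (OutputFeedback.noiseEst D (OutputFeedback.learningPolicy D T) x₀ w v t ω
                - D.atom j))
        ↔ w t ω = D.atom i) ∧
      (∀ i, OutputFeedback.historyProbEst D t
          (fun s => OutputFeedback.output D (OutputFeedback.learningPolicy D T) x₀ w v s ω)
          (fun s => OutputFeedback.input D (OutputFeedback.learningPolicy D T) x₀ w v s ω) i
        = ({s : Fin t | w s ω = D.atom i}.ncard : ℝ) / t)) ∧
    -- the cost of the learning policy
    (∀ T,
      (∀ t ≤ T, (OutputFeedback.dMat D T t).PosSemidef) ∧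
      OutputFeedback.CostIntegrable P D (OutputFeedback.learningPolicy D T) x₀ w v T ∧
      Integrable (fun ω =>
        (D.C⁻¹ *ᵥ (D.C *ᵥ x₀ ω + v 0 ω)) ⬝ᵥ
            (OutputFeedback.riccati D T 0 *ᵥ (D.C⁻¹ *ᵥ (D.C *ᵥ x₀ ω + v 0 ω)))
          + 2 * ((D.C⁻¹ *ᵥ (D.C *ᵥ x₀ ω + v 0 ω)) ⬝ᵥ
            (OutputFeedback.adjointL D T 0 *ᵥ OutputFeedback.meanOf D.atom p))) P ∧
      OutputFeedback.cost P D (OutputFeedback.learningPolicy D T) x₀ w v T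
        = ∫ ω, ((D.C⁻¹ *ᵥ (D.C *ᵥ x₀ ω + v 0 ω)) ⬝ᵥ
              (OutputFeedback.riccati D T 0 *ᵥ (D.C⁻¹ *ᵥ (D.C *ᵥ x₀ ω + v 0 ω)))
            + 2 * ((D.C⁻¹ *ᵥ (D.C *ᵥ x₀ ω + v 0 ω)) ⬝ᵥ
              (OutputFeedback.adjointL D T 0 *ᵥ OutputFeedback.meanOf D.atom p))) ∂P
          + OutputFeedback.hConst D p
              (D.C⁻¹ * OutputFeedback.momentMatrix P (v 0) * (D.C⁻¹)ᵀ) T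
          + (OutputFeedback.dMat D T 0 * vecMulVec (OutputFeedback.meanOf D.atom p)
              (OutputFeedback.meanOf D.atom p)).trace
          + ∑ t ∈ Finset.Icc 1 T, (1 / (t : ℝ)) *
              (OutputFeedback.dMat D T t * OutputFeedback.covariance D.atom p).trace) ∧
    -- the quasi-regret with respect to the offline policy
    (∀ T,
      OutputFeedback.CostIntegrable P D (OutputFeedback.offlinePolicy D p T) x₀ w v T ∧
      OutputFeedback.quasiRegret P D p x₀ w v T
        = (OutputFeedback.dMat D T 0 * vecMulVec (OutputFeedback.meanOf D.atom p)
              (OutputFeedback.meanOf D.atom p)).trace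
          + ∑ t ∈ Finset.Icc 1 T, (1 / (t : ℝ)) *
              (OutputFeedback.dMat D T t * OutputFeedback.covariance D.atom p).trace) ∧
    -- logarithmic growth for constant weights, zero terminal weight, `(A, B)` stabilizable and
    -- `(A, Q^{1/2})` observable
    ((∀ t, D.Q t = D.Q 0) → (∀ t, D.R t = D.R 0) → (∀ T, D.Pterm T = 0) →
      OutputFeedback.Stabilizable D.A D.B →
      (∃ S : Matrix (Fin n) (Fin n) ℝ, S.PosSemidef ∧ S * S = D.Q 0 ∧
        OutputFeedback.Observable D.A S) →
      (fun T : ℕ => OutputFeedback.quasiRegret P D p x₀ w v T)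
        =O[atTop] (fun T : ℕ => Real.log T)) :=
  theorem5_general hC ⟨hQ, hR, hPterm⟩
    ⟨hp, hx₀_meas, hx₀.memLp_two, hw_meas, hw, hv_meas, hv_ident, hv_bdd, hv_mean, hindep⟩ hsep
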